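/- **Networks.** Let $n\in\{1,2\}$. A network $\mathcal G$ in $\mathbb R^d$ consists of finitely many domains $\Omega_1,\dots,\Omega_N\subset\mathbb R^n$, each with its own coordinate system and placed in $\mathbb R^d$ by an isometry (we identify $\Omega_i$ with its image): bounded open segments if $n=1$ (edge-network), bounded connected polygons lying locally on one side of their boundary, without slits or pinched boundary points, if $n=2$ (plane-network). Further there is a finite set $\Gamma$ of bifurcations $\gamma$, which are points if $n=1$ and nondegenerate closed segments if $n=2$. With $I_\gamma=\{i:\gamma\subset\overline{\Omega_i}\}$, each $\gamma\in\Gamma$ satisfies $|I_\gamma|\ge 3$, $\gamma=\bigcap_{i\in I_\gamma}\overline{\Omega_i}$, and $\gamma\subset\partial\Omega_i$ for $i\in I_\gamma$. The domains meet only through bifurcations: if $x\in\overline{\Omega_i}\cap\overline{\Omega_j}$, then $i$ and $j$ are linked by a chain of indices in which any two consecutive ones lie in $I_\gamma$ for some $\gamma\in\Gamma$ with $x\in\gamma$. Let $D_\gamma=\{(i,j)\in I_\gamma^2: i<j\}$, and let $\partial\mathcal G$ be the closure of $\bigcup_i\partial\Omega_i\setminus\bigcup_{\gamma\in\Gamma}\gamma$.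 The space $H^1_0(\mathcal G)$ consists of the families $v=(v_i)$ with $v_i\in H^1(\Omega_i)$ whose traces satisfy $v_i=v_j$ on $\gamma$ for all $i,j\in I_\gamma$, $\gamma\in\Gamma$, and $v_i=0$ on $\partial\Omega_i\cap\partial\mathcal G$. **Meshes.** Let $\mathcal T_h=\bigcup_i\mathcal T_{h,i}$, where $\mathcal T_{h,i}$ is a finite partition of $\overline{\Omega_i}$ into closed intervals ($n=1$) or triangles ($n=2$); the mesh is conforming, also across the domains (any two elements of $\mathcal T_h$ are disjoint or meet in a common vertex or edge). Let $h=\max_K\operatorname{diam}K$. The mesh is shape-regular with constant $\rho>0$: each $K$ contains a ball of radius at least $\operatorname{diam}(K)/\rho$, and if $n=1$ the lengths of any two elements of $\mathcal T_h$ sharing a node (possibly a bifurcation) differ at most by the factor $\rho$. The faces $F$ are the mesh points ($n=1$) or edges ($n=2$): $\mathcal F_{h,i}^{\rm int}$ are those shared by two elements of $\mathcal T_{h,i}$, $\mathcal F_{h,i}^{\partial\mathcal G}$ those of elements of $\mathcal T_{h,i}$ that lie on $\partial\mathcal G$, and $\mathcal F_h^\gamma$ those contained in $\gamma$. For $n=2$,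 $h_F$ is the length of $F$; for $n=1$, $h_F$ is the maximal length of the mesh elements at the point $F$ (also at bifurcations). For $n=1$, $\|\cdot\|_{L^2(F)}$ is the absolute value at $F$. Let $V_h^1$ be the space of $v\in L^2$ with $v|_K$ a polynomial of degree at most one for all $K\in\mathcal T_h$. For penalty parameters $\eta_{F,i},\eta_\gamma\ge\eta_0>0$ and $v\in V_h^1$ set $$\|v\|_{\mathrm{DG}}^2=\sum_{i=1}^N\Big(\sum_{K\in\mathcal T_{h,i}}\|\nabla v\|_{L^2(K)}^2+\sum_{F\in\mathcal F_{h,i}^{\rm int}}\frac{\eta_{F,i}}{h_F}\|[v_i]\|_{L^2(F)}^2+\sum_{F\in\mathcal F_{h,i}^{\partial\mathcal G}}\frac{\eta_{F,i}}{h_F}\|v_i\|_{L^2(F)}^2\Big)+\sum_{\gamma\in\Gamma}\eta_\gamma\sum_{F\in\mathcal F_h^\gamma}\frac1{h_F}\sum_{(i,j)\in D_\gamma}\|v_i-v_j\|_{L^2(F)}^2,$$ where $[v_i]$ is the difference of the traces from the two elements at $F$. **Enriching map.** Let $\mathcal N_h$ be the set of mesh vertices not on $\partial\mathcal G$, $\omega_z$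 the set of elements (of all domains) having the vertex $z$, and $\varphi_z$ the continuous, elementwise affine nodal basis function at $z$ (value $1$ at $z$ and $0$ at all other vertices). For $v\in V_h^1$ set $$E_hv=\sum_{z\in\mathcal N_h}\Big(\frac1{\operatorname{card}(\omega_z)}\sum_{K\in\omega_z}v|_K(z)\Big)\varphi_z .$$ **Lemma.** For every network $\mathcal G$ and all $\rho,\eta_0>0$ there is a constant $C>0$ such that for every mesh of $\mathcal G$ that is conforming and shape-regular with constant $\rho$, all penalty parameters $\eta_{F,i},\eta_\gamma\ge\eta_0$ and all $v\in V_h^1$: 1. $E_hv\in V_h^1\cap H_0^1(\mathcal G)$, and $(E_hv)|_{K}(z)=\frac1{\operatorname{card}(\omega_z)}\sum_{K'\in\omega_z}v|_{K'}(z)$ for all $z\in\mathcal N_h$ and $K\in\omega_z$; 2. $\big(\sum_{i=1}^N\|E_hv-v\|_{L^2(\Omega_i)}^2\big)^{1/2}\le C\,h\,\|v\|_{\mathrm{DG}}$; 3. $\big(\sum_{i=1}^N\|\nabla E_hv\|_{L^2(\Omega_i)}^2\big)^{1/2}\le C\,\|v\|_{\mathrm{DG}}$. -/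

import Mathlib

open Set Filter Topology MeasureTheory
open scoped ContDiff Gradient Classical

noncomputable section

namespace HyperDG

/-- Euclidean space `ℝᵏ`. -/
abbrev E (k : ℕ) := EuclideanSpace ℝ (Fin k)

/-! ### Sobolev functions on an open subset of `ℝⁿ` -/

/-- `W` is a weak gradient of `w` on `Ω`. -/
def HasWeakGradient {n : ℕ} (Ω : Set (E n)) (w : E n → ℝ) (W : E n → E n) : Prop :=
  LocallyIntegrableOn w Ω ∧ LocallyIntegrableOn W Ω ∧
    ∀ φ : E n → ℝ, ContDiff ℝ ∞ φ → HasCompactSupport φ → tsupport φ ⊆ Ω →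
      ∫ x in Ω, w x • ∇ φ x = - ∫ x in Ω, φ x • W x

/-- `w ∈ H¹(Ω)`. -/
def MemH1 {n : ℕ} (Ω : Set (E n)) (w : E n → ℝ) : Prop :=
  MemLp w 2 (volume.restrict Ω) ∧
    ∃ W, HasWeakGradient Ω w W ∧ MemLp W 2 (volume.restrict Ω)

/-- The weak gradient of `w` on `Ω` (unique almost everywhere in `Ω`); zero if there is none. -/
def weakGrad {n : ℕ} (Ω : Set (E n)) (w : E n → ℝ) : E n → E n :=
  if h : ∃ W, HasWeakGradient Ω w W then h.choose else 0

/-- `g ∈ L²(∂Ω)` is the trace of `w ∈ H¹(Ω)`. The trace operator is the continuous extension to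
`H¹(Ω)` of the restriction `u ↦ u|_{∂Ω}` defined on `H¹(Ω) ∩ C(closure Ω)`. -/
def HasTrace {n : ℕ} (Ω : Set (E n)) (w g : E n → ℝ) : Prop :=
  MemLp g 2 (μH[(n : ℝ) - 1].restrict (frontier Ω)) ∧
  ∃ (u : ℕ → E n → ℝ) (U : ℕ → E n → E n) (W : E n → E n),
    (∀ k, ContinuousOn (u k) (closure Ω) ∧ MemLp (u k) 2 (volume.restrict Ω) ∧
      HasWeakGradient Ω (u k) (U k) ∧ MemLp (U k) 2 (volume.restrict Ω)) ∧
    HasWeakGradient Ω w W ∧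
    Tendsto (fun k => eLpNorm (u k - w) 2 (volume.restrict Ω)) atTop (𝓝 0) ∧
    Tendsto (fun k => eLpNorm (U k - W) 2 (volume.restrict Ω)) atTop (𝓝 0) ∧
    Tendsto (fun k => eLpNorm (u k - g) 2 (μH[(n : ℝ) - 1].restrict (frontier Ω)))
      atTop (𝓝 0)

/-! ### Networks -/

/-- For `n = 1` a bounded open interval, for `n = 2` a (Lipschitz) polygonal domain: a bounded
domain whose boundary lies in finitely many points (lines) and which lies on one side of its
boundary (no slits) and is locally connected at its boundary (no pinching). -/
structure IsPolytopalDomain {n : ℕ} (Ω : Set (E n)) : Prop where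
  isOpen : IsOpen Ω
  isConnected : IsConnected Ω
  isBounded : Bornology.IsBounded Ω
  frontier_subset : ∃ A : Set (AffineSubspace ℝ (E n)), A.Finite ∧
    (∀ P ∈ A, Module.finrank ℝ P.direction + 1 = n) ∧ frontier Ω ⊆ ⋃ P ∈ A, (P : Set (E n))
  interior_closure : interior (closure Ω) = Ω
  locally_connected : ∀ x ∈ frontier Ω, ∀ᶠ r in 𝓝[>] (0 : ℝ),
    IsPreconnected (Ω ∩ Metric.ball x r)

/-- A network in `ℝᵈ`: an edge-network for `n = 1`, a plane-network for `n = 2`. Each domain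
`Ω i` is given in its own coordinate system `ℝⁿ` and is placed in `ℝᵈ` by an isometry `Φ i`. -/
structure Network (n d N : ℕ) where
  /-- the segments (`n = 1`) or polygons (`n = 2`) -/
  Ω : Fin N → Set (E n)
  /-- their placement in the ambient space -/
  Φ : Fin N → E n →ᵃⁱ[ℝ] E d
  /-- the bifurcations -/
  Γ : Finset (Set (E d))
  polytopal : ∀ i, IsPolytopalDomain (Ω i)
  /-- bifurcations are points (`n = 1`) or nondegenerate closed segments (`n = 2`) -/
  bif_shape : ∀ γ ∈ Γ, ∃ s : Finset (E d), s.card = n ∧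
    AffineIndependent ℝ ((↑) : s → E d) ∧ γ = convexHull ℝ (s : Set (E d))
  /-- a bifurcation belongs to at least three domains -/
  bif_card : ∀ γ ∈ Γ, 3 ≤ (Finset.univ.filter fun i => γ ⊆ Φ i '' closure (Ω i)).card
  /-- a bifurcation is the intersection of the closed domains that contain it -/
  bif_eq : ∀ γ ∈ Γ, γ = ⋂ i ∈ {i | γ ⊆ Φ i '' closure (Ω i)}, Φ i '' closure (Ω i)
  /-- a bifurcation lies in the boundaries of the domains that contain it -/
  bif_frontier : ∀ γ ∈ Γ, ∀ i, γ ⊆ Φ i '' closure (Ω i) → γ ⊆ Φ i '' frontier (Ω i)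
  /-- the domains meet only through bifurcations: two domains that meet at `x` are linked by
  a chain of domains in which consecutive ones share a bifurcation through `x` -/
  meet : ∀ x i j, x ∈ Φ i '' closure (Ω i) → x ∈ Φ j '' closure (Ω j) →
    Relation.ReflTransGen (fun a b => ∃ γ ∈ Γ, x ∈ γ ∧
      γ ⊆ Φ a '' closure (Ω a) ∧ γ ⊆ Φ b '' closure (Ω b)) i j

namespace Network

variable {n d N : ℕ} (G : Network n d N)

/-- The closed domain `i` in the ambient space. -/
def surf (i : Fin N) : Set (E d) := G.Φ i '' closure (G.Ω i)

/-- The coordinates, in the coordinate system of domain `i`, of a point of its plane. -/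
def coord (i : Fin N) : E d → E n := Function.invFun (G.Φ i)

/-- `I_γ`, the indices of the domains whose closure contains `γ`. -/
def I (γ : Set (E d)) : Finset (Fin N) := Finset.univ.filter fun i => γ ⊆ G.surf i

/-- `D_γ`, the pairs `i < j` of indices in `I_γ`. -/
def D (γ : Set (E d)) : Finset (Fin N × Fin N) :=
  Finset.univ.filter fun p => p.1 < p.2 ∧ p.1 ∈ G.I γ ∧ p.2 ∈ G.I γ

/-- `∂G`, the union of the boundaries of the domains without the bifurcations, as a closed set:
the union of the nodes (closed boundary segments) that belong to one domain only. -/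
def boundary : Set (E d) :=
  closure ((⋃ i, G.Φ i '' frontier (G.Ω i)) \ ⋃ γ ∈ G.Γ, γ)

/-- `v ∈ H¹₀(G)`. A function on the network is a family of functions on the domains. -/
def MemH10 (v : Fin N → E n → ℝ) : Prop :=
  (∀ i, MemH1 (G.Ω i) (v i)) ∧
  ∃ g : Fin N → E n → ℝ, (∀ i, HasTrace (G.Ω i) (v i) (g i)) ∧
    (∀ γ ∈ G.Γ, ∀ i ∈ G.I γ, ∀ j ∈ G.I γ, ∀ᵐ x ∂(μH[(n : ℝ) - 1].restrict γ),
      g i (G.coord i x) = g j (G.coord j x)) ∧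
    ∀ i, ∀ᵐ x ∂(μH[(n : ℝ) - 1].restrict (G.Φ i '' frontier (G.Ω i) ∩ G.boundary)),
      g i (G.coord i x) = 0

/-- A conforming simplicial mesh of the network. An element is given by its set of vertices, in
the coordinates of its domain; as a set, it is the closed simplex spanned by them. The meshes of
different domains match where the domains meet. -/
structure Mesh where
  /-- the elements of each domain -/
  T : Fin N → Finset (Finset (E n))
  card_eq : ∀ i, ∀ K ∈ T i, K.card = n + 1
  indep : ∀ i, ∀ K ∈ T i, AffineIndependent ℝ ((↑) : K → E n)
  cover : ∀ i, ⋃ K ∈ T i, convexHull ℝ (K : Set (E n)) = closure (G.Ω i)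
  conforming : ∀ i j, ∀ K ∈ T i, ∀ L ∈ T j,
    G.Φ i '' convexHull ℝ (K : Set (E n)) ∩ G.Φ j '' convexHull ℝ (L : Set (E n)) ⊆
      convexHull ℝ (G.Φ i '' (K : Set (E n)) ∩ G.Φ j '' (L : Set (E n)))

end Network

/-! ### Piecewise affine functions -/

/-- The diameter of an element or the length of an edge. -/
def size {k : ℕ} (K : Finset (E k)) : ℝ := Metric.diam (convexHull ℝ (K : Set (E k)))

/-- `w` agrees on the element `K` with the polynomial `p` of degree at most one. -/
def AgreesOn {n : ℕ} (w : E n → ℝ) (K : Finset (E n)) (p : E n →ᵃ[ℝ] ℝ) : Prop :=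
  w =ᵐ[volume.restrict (convexHull ℝ (K : Set (E n)))] p

/-- `w|_K` as a polynomial, if `w` agrees on the element `K` with a (unique) polynomial of degree
at most one. -/
def elemPoly {n : ℕ} (w : E n → ℝ) (K : Finset (E n)) : E n →ᵃ[ℝ] ℝ :=
  if h : ∃ p, AgreesOn w K p then h.choose else 0

namespace Network.Mesh

variable {n d N : ℕ} {G : Network n d N} (M : G.Mesh)

/-- All elements, each with the index of its domain. -/
def elems : Finset (Σ _ : Fin N, Finset (E n)) := Finset.univ.sigma M.T

/-- The overall mesh size `h`. -/
def h : ℝ := ⨆ p : M.elems, size p.1.2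

/-- The set of vertices, in the ambient space, of an element. -/
def emb (_ : G.Mesh) (p : Σ _ : Fin N, Finset (E n)) : Finset (E d) := p.2.image (G.Φ p.1)

/-- Shape regularity with constant `ρ`: each element contains a ball of radius at least `1 / ρ`
times its diameter; for intervals, where this says nothing, the lengths of two elements that
share a node are within the factor `ρ`. -/
def ShapeRegular (ρ : ℝ) : Prop :=
  (∀ p ∈ M.elems, ∃ c, Metric.closedBall c (size p.2 / ρ) ⊆ convexHull ℝ (p.2 : Set (E n))) ∧
  (n = 1 → ∀ p ∈ M.elems, ∀ q ∈ M.elems, (M.emb p ∩ M.emb q).Nonempty →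
    size p.2 ≤ ρ * size q.2)

/-- `v ∈ V_h^1`. -/
def MemV (v : Fin N → E n → ℝ) : Prop :=
  ∀ i, MemLp (v i) 2 (volume.restrict (G.Ω i)) ∧ ∀ K ∈ M.T i, ∃ p, AgreesOn (v i) K p

/-- The value at a point of the ambient space of the polynomial `v|_K`, for an element `K` of
domain `i`. -/
def val (_ : G.Mesh) (v : Fin N → E n → ℝ) (i : Fin N) (K : Finset (E n)) (x : E d) : ℝ :=
  elemPoly (v i) K (G.coord i x)

/-! #### Faces: points for `n = 1`, edges for `n = 2`, given by their vertices in `ℝᵈ` -/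

/-- All mesh faces. -/
def faces : Finset (Finset (E d)) := M.elems.biUnion fun p => (M.emb p).powersetCard n

/-- The elements of domain `i` that have the face `F`. -/
def elemsAt (i : Fin N) (F : Finset (E d)) : Finset (Finset (E n)) :=
  (M.T i).filter fun K => F ⊆ M.emb ⟨i, K⟩

/-- The interior faces of domain `i`, shared by two elements of it. -/
def intFaces (i : Fin N) : Finset (Finset (E d)) :=
  M.faces.filter fun F => 2 ≤ (M.elemsAt i F).card

/-- The faces of domain `i` on `∂G`. -/
def bdFaces (i : Fin N) : Finset (Finset (E d)) :=
  M.faces.filter fun F =>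
    (M.elemsAt i F).Nonempty ∧ convexHull ℝ (F : Set (E d)) ⊆ G.boundary

/-- The faces that partition the bifurcation `γ`. -/
def bifFaces (γ : Set (E d)) : Finset (Finset (E d)) :=
  M.faces.filter fun F => convexHull ℝ (F : Set (E d)) ⊆ γ

/-- `h_F`: for `n = 1` the maximal length of the elements at the point `F` (at a bifurcation this
is `h_γ`), for `n = 2` the length of the edge `F`. -/
def hF (F : Finset (E d)) : ℝ :=
  if n = 1 then ⨆ p : M.elems.filter (fun p => F ⊆ M.emb p), size p.1.2 else size F

/-- `‖f‖²` in `L²(F)`; for `n = 1` this is the square of the value of `f` at the point `F`. -/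
def faceSq (_ : G.Mesh) (F : Finset (E d)) (f : E d → ℝ) : ℝ :=
  ∫ x in convexHull ℝ (F : Set (E d)), f x ^ 2 ∂μH[(n : ℝ) - 1]

/-- `‖v‖²_{DG,i}`. An interior face is counted once for each order of its two elements, hence the
factor `1 / 2`; a face on `∂G` belongs to one element of domain `i`. -/
def dgSqDom (ηF : Fin N → Finset (E d) → ℝ) (v : Fin N → E n → ℝ) (i : Fin N) : ℝ :=
  ∑ K ∈ M.T i, (∫ x in convexHull ℝ (K : Set (E n)), ‖∇ (elemPoly (v i) K : E n → ℝ) x‖ ^ 2) +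
  ∑ F ∈ M.intFaces i, ηF i F / M.hF F *
    (1 / 2 * ∑ q ∈ (M.elemsAt i F).offDiag,
      M.faceSq F fun x => M.val v i q.1 x - M.val v i q.2 x) +
  ∑ F ∈ M.bdFaces i, ηF i F / M.hF F * ∑ K ∈ M.elemsAt i F, M.faceSq F fun x => M.val v i K x

/-- The DG norm, with penalty parameters `ηF i F` for the faces on and inside the domains and
`ηΓ γ` for the bifurcations. A face on a bifurcation `γ` belongs to exactly one element of each
domain `i ∈ I_γ`. -/
def dgNorm (ηF : Fin N → Finset (E d) → ℝ) (ηΓ : Set (E d) → ℝ) (v : Fin N → E n → ℝ) : ℝ :=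
  Real.sqrt (∑ i, M.dgSqDom ηF v i +
    ∑ γ ∈ G.Γ, ηΓ γ * ∑ F ∈ M.bifFaces γ, 1 / M.hF F * ∑ p ∈ G.D γ,
      ∑ K ∈ M.elemsAt p.1 F, ∑ L ∈ M.elemsAt p.2 F,
        M.faceSq F fun x => M.val v p.1 K x - M.val v p.2 L x)

/-! #### The enriching map -/

/-- `N_h`, the mesh vertices that do not belong to `∂G`. -/
def nodes : Finset (E d) := (M.elems.biUnion M.emb).filter fun z => z ∉ G.boundary

/-- `ω_z`, the elements (of all domains) that have the vertex `z`. -/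
def patch (z : E d) : Finset (Σ _ : Fin N, Finset (E n)) := M.elems.filter fun p => z ∈ M.emb p

/-- The nodal value `E_h v (z)`: the mean of the values at `z` of `v` on the elements at `z`. -/
def nodalAvg (v : Fin N → E n → ℝ) (z : E d) : ℝ :=
  ((M.patch z).card : ℝ)⁻¹ * ∑ p ∈ M.patch z, M.val v p.1 p.2 z

/-- The polynomial of degree one on the element `K` of domain `i` whose value is one at the
vertex `z` and zero at the other vertices (zero if `z` is not a vertex of `K`). -/
def bary (_ : G.Mesh) (i : Fin N) (K : Finset (E n)) (z : E d) : E n →ᵃ[ℝ] ℝ :=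
  if h : ∃ p : E n →ᵃ[ℝ] ℝ, ∀ y ∈ K, p y = if G.Φ i y = z then 1 else 0 then h.choose else 0

/-- The nodal basis function `φ_z`, which equals `bary i K z` on each closed element `K` of each
domain `i`. -/
def hat (z : E d) (i : Fin N) (x : E n) : ℝ :=
  if h : ∃ K ∈ M.T i, x ∈ convexHull ℝ (K : Set (E n)) then M.bary i h.choose z x else 0

/-- The enriching map `E_h`. -/
def enrich (v : Fin N → E n → ℝ) (i : Fin N) (x : E n) : ℝ :=
  ∑ z ∈ M.nodes, M.nodalAvg v z * M.hat z i x

end Network.Mesh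

end HyperDG

end

/-!
Two elements with a common vertex `z` are joined by a chain of elements at `z` in which consecutive
ones share a face through `z`. Along such a chain the value of `v` at `z` jumps, by an inverse
inequality on the faces, by no more than the penalty terms of these faces, and the number of
elements at `z` is bounded by comparing volumes. Hence the mean of the values of `v` at `z` is
close to each of them. If `z` lies on `∂G`, the chain can be continued to an element with a face on
`∂G`, so that the values of `v` at `z` are small. An affine function and its gradient on an element
are controlled by the values at the vertices, scaled by the size of the element.
-/

noncomputable section

namespace HyperDG

/-! ### Open simplices and simplicial complexes -/

section OpenSimplex

variable {V : Type*} [AddCommGroup V] [Module ℝ V] {A F T : Finset V} {x y z : V}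

/-- The open simplex spanned by a finite set of points: the convex combinations in which every
point has a positive weight. The open simplices of the faces of a simplicial complex partition its
space, and a single point is its own open simplex. -/
def openSimplex (F : Finset V) : Set V :=
  {x | ∃ w : V → ℝ, (∀ a ∈ F, 0 < w a) ∧ ∑ a ∈ F, w a = 1 ∧ ∑ a ∈ F, w a • a = x}

lemma nonempty_of_mem_openSimplex (h : x ∈ openSimplex F) : F.Nonempty := by
  obtain ⟨w, -, hw, -⟩ := h
  exact Finset.nonempty_of_sum_ne_zero (hw.trans_ne one_ne_zero)

lemma openSimplex_subset_convexHull : openSimplex F ⊆ convexHull ℝ (F : Set V) := by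
  rintro x ⟨w, hpos, hsum, hx⟩
  exact Finset.mem_convexHull'.2 ⟨w, fun a ha => (hpos a ha).le, hsum, hx⟩

lemma openSimplex_singleton : openSimplex {z} = {z} := by
  refine Subset.antisymm (by simpa using openSimplex_subset_convexHull (F := {z})) ?_
  rintro _ rfl
  exact ⟨1, by simp, by simp, by simp⟩

lemma mem_openSimplex_singleton_self : z ∈ openSimplex {z} := by
  simp [openSimplex_singleton]

lemma exists_mem_openSimplex (h : x ∈ convexHull ℝ (A : Set V)) : ∃ F ⊆ A, x ∈ openSimplex F := by
  obtain ⟨w, h0, h1, h2⟩ := Finset.mem_convexHull'.1 h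
  refine ⟨A.filter (w · ≠ 0), Finset.filter_subset _ _, w, fun a ha => ?_, ?_, ?_⟩
  · rw [Finset.mem_filter] at ha
    exact (h0 a ha.1).lt_of_ne' ha.2
  · rw [Finset.sum_filter_ne_zero, h1]
  · rw [← h2]
    exact Finset.sum_filter_of_ne fun a _ hne h => hne (by rw [h, zero_smul])

lemma two_le_card_of_mem_convexHull (hz : z ∈ F) (hx : x ∈ convexHull ℝ (F : Set V))
    (hxz : x ≠ z) : 2 ≤ F.card := by
  rw [Nat.succ_le_iff, Finset.one_lt_card_iff_nontrivial]
  refine ⟨z, hz, ?_⟩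
  by_contra! h
  obtain rfl : F = {z} := Finset.eq_singleton_iff_unique_mem.2 ⟨hz, fun a ha => (h a ha).symm⟩
  exact hxz (by simpa using hx)

/-- The convex weights of a point are unique. -/
lemma subset_of_mem_openSimplex (hF : AffineIndependent ℝ ((↑) : F → V)) (hT : T ⊆ F)
    (hx : x ∈ openSimplex F) (hxT : x ∈ convexHull ℝ (T : Set V)) : F ⊆ T := by
  obtain ⟨w, hpos, hw, hwx⟩ := hx
  obtain ⟨u, -, hu, hux⟩ := Finset.mem_convexHull'.1 hxT
  intro a ha
  by_contra haT
  have h0 := hF.eq_zero_of_sum_eq_zero_subtype (w := fun b => w b - if b ∈ T then u b else 0)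
    (by simp [Finset.sum_ite_mem, Finset.inter_eq_right.2 hT, hw, hu])
    (by simp [sub_smul, ite_smul, Finset.sum_ite_mem, Finset.inter_eq_right.2 hT, hwx, hux]) a ha
  exact (hpos a ha).ne' (by simpa [haT] using h0)

lemma lineMap_mem_openSimplex (hx : x ∈ openSimplex F) (hy : y ∈ convexHull ℝ (F : Set V)) {t : ℝ}
    (ht : t ∈ Ioc (0 : ℝ) 1) : AffineMap.lineMap y x t ∈ openSimplex F := by
  obtain ⟨w, hpos, hw, rfl⟩ := hx
  obtain ⟨u, hu0, hu, rfl⟩ := Finset.mem_convexHull'.1 hy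
  refine ⟨fun a => (1 - t) * u a + t * w a, fun a ha => ?_, ?_, ?_⟩
  · have := mul_nonneg (sub_nonneg.2 ht.2) (hu0 a ha)
    have := mul_pos ht.1 (hpos a ha)
    linarith
  · rw [Finset.sum_add_distrib, ← Finset.mul_sum, ← Finset.mul_sum, hw, hu]
    ring
  · simp only [add_smul, mul_smul, Finset.sum_add_distrib, ← Finset.smul_sum,
      AffineMap.lineMap_apply_module]

lemma exists_homothety_eq_of_mem_openSimplex (hx : x ∈ openSimplex F)
    (hy : y ∈ convexHull ℝ (F : Set V)) :
    ∃ b ∈ convexHull ℝ (F : Set V), ∃ t ∈ Ioc (0 : ℝ) 1, AffineMap.homothety b t y = x := by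
  have hne := nonempty_of_mem_openSimplex hx
  obtain ⟨w, hpos, hw, rfl⟩ := hx
  obtain ⟨u, hu0, hu, rfl⟩ := Finset.mem_convexHull'.1 hy
  obtain ⟨a₀, ha₀, hmin⟩ := F.exists_min_image w hne
  set ε := w a₀
  have hε : 0 < ε := hpos a₀ ha₀
  refine ⟨∑ a ∈ F, ((1 + ε) * w a - ε * u a) • a,
    Finset.mem_convexHull'.2 ⟨_, fun a ha => ?_, ?_, rfl⟩, ε / (1 + ε),
    ⟨by positivity, (div_le_one (by positivity)).2 (by linarith)⟩, ?_⟩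
  · have hu1 : u a ≤ 1 := hu ▸ Finset.single_le_sum hu0 ha
    nlinarith [hmin a ha, hpos a ha]
  · rw [Finset.sum_sub_distrib, ← Finset.mul_sum, ← Finset.mul_sum, hw, hu]
    ring
  · simp only [AffineMap.homothety_eq_lineMap, AffineMap.lineMap_apply_module, sub_smul, mul_smul,
      Finset.sum_sub_distrib, ← Finset.smul_sum]
    match_scalars <;> field_simp <;> ring

lemma convexHull_subset_closure_openSimplex [TopologicalSpace V] [IsTopologicalAddGroup V]
    [ContinuousSMul ℝ V] (hx : x ∈ openSimplex F) :
    convexHull ℝ (F : Set V) ⊆ closure (openSimplex F) := by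
  intro y hy
  have hlim : Tendsto (AffineMap.lineMap y x : ℝ → V) (𝓝[>] 0) (𝓝 y) := by
    simpa using (AffineMap.lineMap_continuous (p := y) (q := x) (R := ℝ)).continuousWithinAt
      (x := (0 : ℝ)) (s := Ioi 0) |>.tendsto
  exact mem_closure_of_tendsto hlim (mem_of_superset (Ioc_mem_nhdsGT zero_lt_one)
    fun _ ht => lineMap_mem_openSimplex hx hy ht)

variable {W : Type*} [AddCommGroup W] [Module ℝ W]

lemma openSimplex_image [DecidableEq W] {f : V →ᵃ[ℝ] W} (hf : Function.Injective f) :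
    openSimplex (F.image f) = f '' openSimplex F := by
  have himage : ∀ w : V → ℝ, ∑ a ∈ F, w a = 1 → f (∑ a ∈ F, w a • a) = ∑ a ∈ F, w a • f a := by
    intro w hw
    rw [← F.affineCombination_eq_linear_combination _ w hw, F.map_affineCombination _ _ hw,
      F.affineCombination_eq_linear_combination _ w hw]
    rfl
  ext x
  constructor
  · rintro ⟨w, hpos, hw, rfl⟩
    rw [Finset.sum_image hf.injOn] at hw ⊢
    exact ⟨_, ⟨fun a => w (f a), fun a ha => hpos _ (Finset.mem_image_of_mem f ha), hw, rfl⟩,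
      himage (fun a => w (f a)) hw⟩
  · rintro ⟨_, ⟨w, hpos, hw, rfl⟩, rfl⟩
    have hinv := Function.leftInverse_invFun hf
    refine ⟨w ∘ Function.invFun f, Finset.forall_mem_image.2 fun a ha => ?_, ?_, ?_⟩
    · simpa [hinv a] using hpos a ha
    · simpa [Finset.sum_image hf.injOn, hinv _] using hw
    · simp [Finset.sum_image hf.injOn, hinv _, himage w hw]

section Topology

variable [TopologicalSpace V] [IsTopologicalAddGroup V] [ContinuousConstSMul ℝ V]

/-- If a union of convex sets that contain `F` is a neighbourhood of one point of the closed
simplex, homotheties centred in the closed simplex carry it to the other points. -/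
lemma openSimplex_subset_interior_biUnion {ι : Type*} {s : Set ι} {C : ι → Set V}
    (hC : ∀ k ∈ s, Convex ℝ (C k)) (hF : ∀ k ∈ s, (F : Set V) ⊆ C k)
    (hy : y ∈ convexHull ℝ (F : Set V)) (hint : y ∈ interior (⋃ k ∈ s, C k)) :
    openSimplex F ⊆ interior (⋃ k ∈ s, C k) := by
  intro x hx
  obtain ⟨b, hb, t, ht, rfl⟩ := exists_homothety_eq_of_mem_openSimplex hx hy
  have hopen := AffineMap.homothety_isOpenMap b t ht.1.ne'
  refine interior_maximal ?_ (hopen _ isOpen_interior) (mem_image_of_mem _ hint)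
  rintro _ ⟨z, hz, rfl⟩
  obtain ⟨k, hk, hzk⟩ := mem_iUnion₂.1 (interior_subset hz)
  rw [AffineMap.homothety_eq_lineMap]
  exact mem_iUnion₂.2 ⟨k, hk, (hC k hk).lineMap_mem
    (convexHull_min (hF k hk) (hC k hk) hb) hzk ⟨ht.1.le, ht.2⟩⟩

lemma openSimplex_subset_interior_convexHull
    (hF : (interior (convexHull ℝ (F : Set V))).Nonempty) :
    openSimplex F ⊆ interior (convexHull ℝ (F : Set V)) := by
  obtain ⟨y, hy⟩ := hF
  have h := openSimplex_subset_interior_biUnion (s := {F}) (C := fun K => convexHull ℝ (K : Set V))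
    (fun K _ => convex_convexHull ℝ _) (by simpa using subset_convexHull ℝ (F : Set V))
    (interior_subset hy)
  simpa only [biUnion_singleton, hy, forall_const] using h

end Topology

end OpenSimplex

section FullDimensional

variable {V : Type*} [NormedAddCommGroup V] [NormedSpace ℝ V] [FiniteDimensional ℝ V]
  {K S : Finset V}

lemma affineSpan_eq_top_iff_card_eq_finrank_add_one
    (hK : AffineIndependent ℝ ((↑) : K → V)) :
    affineSpan ℝ (K : Set V) = ⊤ ↔ K.card = Module.finrank ℝ V + 1 := by
  simpa using hK.affineSpan_eq_top_iff_card_eq_finrank_add_one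

lemma interior_convexHull_nonempty (hK : AffineIndependent ℝ ((↑) : K → V))
    (hcard : K.card = Module.finrank ℝ V + 1) :
    (interior (convexHull ℝ (K : Set V))).Nonempty := by
  rwa [interior_convexHull_nonempty_iff_affineSpan_eq_top,
    affineSpan_eq_top_iff_card_eq_finrank_add_one hK]

lemma addHaar_convexHull_eq_zero [MeasurableSpace V] [BorelSpace V] (μ : Measure V)
    [μ.IsAddHaarMeasure] (hS : AffineIndependent ℝ ((↑) : S → V))
    (hcard : S.card ≠ Module.finrank ℝ V + 1) : μ (convexHull ℝ (S : Set V)) = 0 :=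
  measure_mono_null (convexHull_subset_affineSpan _) (Measure.addHaar_affineSubspace μ _
    fun htop => hcard ((affineSpan_eq_top_iff_card_eq_finrank_add_one hS).1 htop))

end FullDimensional

section SimplicialComplex

variable {V : Type*} [AddCommGroup V] [Module ℝ V]

/-- The simplicial complex that consists of the faces of given simplices, which are affinely
independent and meet in common faces. -/
def complexOfFacets (T : Set (Finset V)) (indep : ∀ K ∈ T, AffineIndependent ℝ ((↑) : K → V))
    (conforming : ∀ K ∈ T, ∀ L ∈ T, convexHull ℝ (K : Set V) ∩ convexHull ℝ (L : Set V) ⊆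
      convexHull ℝ (K ∩ L : Set V)) : Geometry.SimplicialComplex ℝ V where
  faces := {S | S.Nonempty ∧ ∃ K ∈ T, S ⊆ K}
  isRelLowerSet_faces := by
    rintro S ⟨hne, K, hK, hS⟩
    exact ⟨hne, fun S' hS' hne' => ⟨hne', K, hK, hS'.trans hS⟩⟩
  indep := by
    rintro S ⟨-, K, hK, hS⟩
    exact (indep K hK).mono hS
  inter_subset_convexHull := by
    rintro S S' ⟨-, K, hK, hS⟩ ⟨-, L, hL, hS'⟩ x ⟨hxS, hxS'⟩
    have hx := conforming K hK L hL ⟨convexHull_mono hS hxS, convexHull_mono hS' hxS'⟩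
    rw [← Finset.coe_inter] at hx
    have hxSL : x ∈ convexHull ℝ ((S ∩ (K ∩ L) : Finset V) : Set V) := by
      rw [Finset.coe_inter, (indep K hK).convexHull_inter hS Finset.inter_subset_left]
      exact ⟨hxS, hx⟩
    have hxSL' : x ∈ convexHull ℝ ((S ∩ (K ∩ L) : Finset V) ∩ S' : Set V) := by
      rw [(indep L hL).convexHull_inter
        (Finset.inter_subset_right.trans Finset.inter_subset_right) hS']
      exact ⟨hxSL, hxS'⟩
    refine convexHull_mono (inter_subset_inter_left _ ?_) hxSL'
    exact Finset.coe_subset.2 Finset.inter_subset_left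

variable {C : Geometry.SimplicialComplex ℝ V} {F S : Finset V} {x z : V}

lemma face_subset_of_mem_openSimplex (hF : F ∈ C.faces) (hS : S ∈ C.faces)
    (hx : x ∈ openSimplex F) (hxS : x ∈ convexHull ℝ (S : Set V)) : F ⊆ S := by
  have hxFS := C.inter_subset_convexHull hF hS ⟨openSimplex_subset_convexHull hx, hxS⟩
  rw [← Finset.coe_inter] at hxFS
  exact (subset_of_mem_openSimplex (C.indep hF) Finset.inter_subset_left hx hxFS).trans
    Finset.inter_subset_right

lemma exists_face_mem_openSimplex (hx : x ∈ C.space) : ∃ F ∈ C.faces, x ∈ openSimplex F := by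
  obtain ⟨S, hS, hxS⟩ := Geometry.SimplicialComplex.mem_space_iff.1 hx
  obtain ⟨F, hFS, hxF⟩ := exists_mem_openSimplex hxS
  exact ⟨F, C.down_closed hS hFS (nonempty_of_mem_openSimplex hxF), hxF⟩

variable [TopologicalSpace V] [IsTopologicalAddGroup V] [ContinuousSMul ℝ V] [T2Space V]

lemma eventually_face_subset (hfin : C.faces.Finite) (hF : F ∈ C.faces) (hz : z ∈ openSimplex F) :
    ∀ᶠ x in 𝓝 z, ∀ S ∈ C.faces, x ∈ convexHull ℝ (S : Set V) → F ⊆ S := by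
  rw [eventually_all_finite hfin]
  intro S hS
  by_cases hFS : F ⊆ S
  · exact .of_forall fun _ _ => hFS
  · have hzS : z ∉ convexHull ℝ (S : Set V) :=
      fun h => hFS (face_subset_of_mem_openSimplex hF hS hz h)
    filter_upwards [(S.finite_toSet.isClosed_convexHull ℝ).isOpen_compl.mem_nhds hzS]
      with x hx hxS using absurd hxS hx

lemma openSimplex_subset_interior_space (hfin : C.faces.Finite) (hF : F ∈ C.faces)
    (h : (openSimplex F ∩ interior C.space).Nonempty) : openSimplex F ⊆ interior C.space := by
  obtain ⟨z, hzF, hz⟩ := h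
  have hstar : z ∈ interior (⋃ S ∈ {S ∈ C.faces | F ⊆ S}, convexHull ℝ (S : Set V)) := by
    rw [mem_interior_iff_mem_nhds]
    filter_upwards [isOpen_interior.mem_nhds hz, eventually_face_subset hfin hF hzF] with x hx hxF
    obtain ⟨S, hS, hxS⟩ := Geometry.SimplicialComplex.mem_space_iff.1 (interior_subset hx)
    exact mem_iUnion₂.2 ⟨S, ⟨hS, hxF S hS hxS⟩, hxS⟩
  refine (openSimplex_subset_interior_biUnion (fun S _ => convex_convexHull ℝ _)
    (fun S hS => (Finset.coe_subset.2 hS.2).trans (subset_convexHull ℝ _))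
    (openSimplex_subset_convexHull hzF) hstar).trans (interior_mono ?_)
  exact iUnion₂_subset fun S hS => Geometry.SimplicialComplex.convexHull_subset_space hS.1

end SimplicialComplex

/-! ### Connectedness -/

section Connected

lemma reflTransGen_inter_of_isPreconnected {X ι : Type*} [TopologicalSpace X] {U : Set X}
    (hU : IsPreconnected U) {s : Finset ι} {C : ι → Set X} (hC : ∀ k ∈ s, IsClosed (C k))
    (hcover : U ⊆ ⋃ k ∈ s, C k) (hmeet : ∀ k ∈ s, (U ∩ C k).Nonempty) {k l : ι} (hk : k ∈ s)
    (hl : l ∈ s) :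
    Relation.ReflTransGen (fun a b => a ∈ s ∧ b ∈ s ∧ (U ∩ (C a ∩ C b)).Nonempty) k l := by
  set R : ι → ι → Prop := fun a b => a ∈ s ∧ b ∈ s ∧ (U ∩ (C a ∩ C b)).Nonempty
  by_contra hkl
  have hclosed : ∀ P : ι → Prop, IsClosed (⋃ a ∈ {a | a ∈ s ∧ P a}, C a) := fun P =>
    (s.finite_toSet.subset fun a ha => ha.1).isClosed_biUnion fun a ha => hC a ha.1
  have hinter : ∀ P : ι → Prop, ∀ a ∈ s, P a → (U ∩ ⋃ a ∈ {a | a ∈ s ∧ P a}, C a).Nonempty :=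
    fun P a ha hPa => (hmeet a ha).mono (inter_subset_inter_right _
      (subset_biUnion_of_mem (u := C) (show a ∈ {a | a ∈ s ∧ P a} from ⟨ha, hPa⟩)))
  obtain ⟨x, hxU, hx, hx'⟩ := isPreconnected_closed_iff.1 hU _ _
    (hclosed (Relation.ReflTransGen R k)) (hclosed (¬ Relation.ReflTransGen R k ·)) (by
      intro x hx
      obtain ⟨a, ha, hxa⟩ := mem_iUnion₂.1 (hcover hx)
      by_cases h : Relation.ReflTransGen R k a
      · exact Or.inl (mem_iUnion₂.2 ⟨a, ⟨ha, h⟩, hxa⟩)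
      · exact Or.inr (mem_iUnion₂.2 ⟨a, ⟨ha, h⟩, hxa⟩))
    (hinter _ k hk .refl) (hinter _ l hl hkl)
  obtain ⟨a, ha, hxa⟩ := mem_iUnion₂.1 hx
  obtain ⟨b, hb, hxb⟩ := mem_iUnion₂.1 hx'
  exact hb.2 (ha.2.tail ⟨ha.1, hb.1, x, hxU, hxa, hxb⟩)

variable {V : Type*} [NormedAddCommGroup V] [NormedSpace ℝ V]

lemma isPreconnected_ball_diff_singleton (hV : 1 < Module.rank ℝ V)
    (y : V) {r : ℝ} (hr : 0 < r) : IsPreconnected (Metric.ball y r \ {y}) := by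
  set e := OpenPartialHomeomorph.univBall y r
  have himage : e '' {0}ᶜ = Metric.ball y r \ {y} := by
    rw [← OpenPartialHomeomorph.univBall_target y hr, ← e.image_source_eq_target,
      OpenPartialHomeomorph.univBall_source, compl_eq_univ_sdiff, image_sdiff, image_singleton,
      OpenPartialHomeomorph.univBall_apply_zero]
    exact injOn_univ.1 (OpenPartialHomeomorph.univBall_source y r ▸ e.injOn)
  rw [← himage]
  exact (isConnected_compl_singleton_of_one_lt_rank hV 0).isPreconnected.image _
    (OpenPartialHomeomorph.continuous_univBall y r).continuousOn

lemma preperfect_frontier (hV : 1 < Module.rank ℝ V) {Ω : Set V}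
    (hΩ : IsOpen Ω) (hreg : interior (closure Ω) = Ω) : Preperfect (frontier Ω) := by
  rw [preperfect_iff_nhds]
  intro y hy U hU
  obtain ⟨r, hr, hrU⟩ := Metric.mem_nhds_iff.1 hU
  by_contra! hU'
  have hyΩ : y ∉ Ω := (hΩ.frontier_eq ▸ hy).2
  have hmeet : ((Metric.ball y r \ {y}) ∩ Ω).Nonempty := by
    obtain ⟨x, hx, hxy⟩ := Metric.mem_closure_iff.1 hy.1 r hr
    exact ⟨x, ⟨Metric.mem_ball'.2 hxy, fun h => hyΩ (h ▸ hx)⟩, hx⟩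
  have hcover : Metric.ball y r \ {y} ⊆ Ω ∪ (closure Ω)ᶜ := by
    intro x hx
    by_contra! hxc
    rw [mem_union, not_or, notMem_compl_iff] at hxc
    exact hx.2 (hU' x ⟨hrU hx.1, hΩ.frontier_eq ▸ ⟨hxc.2, hxc.1⟩⟩)
  have hsub : Metric.ball y r \ {y} ⊆ Ω :=
    (isPreconnected_ball_diff_singleton hV y hr).subset_left_of_subset_union hΩ
      isClosed_closure.isOpen_compl (disjoint_compl_right_iff_subset.2 subset_closure) hcover hmeet
  have hball : Metric.ball y r ⊆ closure Ω := by
    rw [← insert_eq_of_mem (Metric.mem_ball_self hr), ← insert_sdiff_singleton]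
    exact insert_subset hy.1 (hsub.trans subset_closure)
  exact hyΩ (hreg ▸ interior_maximal hball Metric.isOpen_ball (Metric.mem_ball_self hr))

end Connected

/-! ### Meshes as simplicial complexes -/

/-- A simplex of one of the domains: the index of the domain and the set of vertices, in the
coordinates of the domain. -/
abbrev Elem (n N : ℕ) := Σ _ : Fin N, Finset (E n)

namespace IsPolytopalDomain

variable {n : ℕ} {Ω : Set (E n)} {y : E n}

lemma frontier_eq (h : IsPolytopalDomain Ω) : frontier Ω = closure Ω \ Ω :=
  h.isOpen.frontier_eq

lemma eventually_isPreconnected_inter_ball_diff (h : IsPolytopalDomain Ω) (hn : 1 < n)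
    (hy : y ∈ closure Ω) :
    ∀ᶠ r in 𝓝[>] (0 : ℝ), IsPreconnected ((Ω ∩ Metric.ball y r) \ {y}) := by
  by_cases hyΩ : y ∈ Ω
  · obtain ⟨r₀, hr₀, hsub⟩ := Metric.isOpen_iff.1 h.isOpen y hyΩ
    filter_upwards [Ioo_mem_nhdsGT hr₀] with r hr
    rw [inter_eq_right.2 ((Metric.ball_subset_ball hr.2.le).trans hsub)]
    exact isPreconnected_ball_diff_singleton
      (Module.one_lt_rank_of_one_lt_finrank (by simpa using hn)) y hr.1
  · filter_upwards [h.locally_connected y (h.frontier_eq ▸ ⟨hy, hyΩ⟩)] with r hr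
    rwa [sdiff_singleton_eq_self fun hy => hyΩ hy.1]

lemma preperfect_frontier (h : IsPolytopalDomain Ω) (hn : 1 < n) : Preperfect (frontier Ω) :=
  HyperDG.preperfect_frontier (Module.one_lt_rank_of_one_lt_finrank (by simpa using hn)) h.isOpen
    h.interior_closure

end IsPolytopalDomain

namespace Network

variable {n d N : ℕ} (G : Network n d N) {γ : Set (E d)} {i : Fin N}

lemma coord_apply (i : Fin N) (y : E n) : G.coord i (G.Φ i y) = y :=
  Function.leftInverse_invFun (G.Φ i).injective y

lemma mem_I : i ∈ G.I γ ↔ γ ⊆ G.surf i := by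
  simp [I]

lemma convex_of_mem_Γ (hγ : γ ∈ G.Γ) : Convex ℝ γ := by
  obtain ⟨s, -, -, rfl⟩ := G.bif_shape γ hγ
  exact convex_convexHull ℝ _

lemma isClosed_of_mem_Γ (hγ : γ ∈ G.Γ) : IsClosed γ := by
  obtain ⟨s, -, -, rfl⟩ := G.bif_shape γ hγ
  exact s.finite_toSet.isClosed_convexHull ℝ

lemma preperfect_of_mem_Γ (hn : 1 < n) (hγ : γ ∈ G.Γ) : Preperfect γ := by
  obtain ⟨s, hs, -, rfl⟩ := G.bif_shape γ hγ
  have hs : (s : Set (E d)).Nontrivial := Finset.one_lt_card_iff_nontrivial.1 (hs.symm ▸ hn)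
  exact (convex_convexHull ℝ _).isPreconnected.preperfect_of_nontrivial
    (hs.mono (subset_convexHull ℝ _))

/-- The boundary points of the domains that lie on no bifurcation; `∂G` is the closure. -/
def outerFrontier : Set (E d) := (⋃ i, G.Φ i '' frontier (G.Ω i)) \ ⋃ γ ∈ G.Γ, γ

lemma preperfect_outerFrontier (hn : 1 < n) : Preperfect G.outerFrontier := by
  have hclosed : IsClosed (⋃ γ ∈ G.Γ, γ) := isClosed_biUnion_finset fun γ => G.isClosed_of_mem_Γ
  rw [outerFrontier, sdiff_eq, inter_comm]
  refine Preperfect.open_inter (fun x hx => ?_) hclosed.isOpen_compl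
  obtain ⟨i, y, hy, rfl⟩ := mem_iUnion.1 hx
  have hacc := (G.polytopal i).preperfect_frontier hn y hy
  refine (hacc.map (G.Φ i).continuous.continuousAt (G.Φ i).injective).mono ?_
  rw [map_principal]
  exact principal_mono.2 (subset_iUnion (fun i => G.Φ i '' frontier (G.Ω i)) i)

namespace Mesh

variable {G} (M : G.Mesh) {p q : Elem n N} {K L : Finset (E n)} {F : Finset (E d)} {x z : E d}

lemma mem_elems : p ∈ M.elems ↔ p.2 ∈ M.T p.1 := by
  simp [elems]

lemma apply_mem_emb {y : E n} : G.Φ p.1 y ∈ M.emb p ↔ y ∈ p.2 := by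
  simp [emb]

lemma coe_emb (p : Elem n N) : (M.emb p : Set (E d)) = G.Φ p.1 '' (p.2 : Set (E n)) := by
  simp [emb]

lemma convexHull_emb (p : Elem n N) :
    convexHull ℝ (M.emb p : Set (E d)) = G.Φ p.1 '' convexHull ℝ (p.2 : Set (E n)) := by
  rw [coe_emb]
  exact ((G.Φ p.1).toAffineMap.image_convexHull _).symm

lemma card_emb (hp : p ∈ M.elems) : (M.emb p).card = n + 1 := by
  rw [emb, Finset.card_image_of_injective _ (G.Φ p.1).injective, M.card_eq _ _ (M.mem_elems.1 hp)]

lemma affineIndependent_emb (hp : p ∈ M.elems) : AffineIndependent ℝ ((↑) : M.emb p → E d) := by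
  have h := ((M.indep _ _ (M.mem_elems.1 hp)).map' (G.Φ p.1).toAffineMap (G.Φ p.1).injective).range
  have hrange : range ((G.Φ p.1).toAffineMap ∘ ((↑) : p.2 → E n)) = (M.emb p : Set (E d)) := by
    rw [coe_emb, range_comp, Subtype.range_coe]
    rfl
  rwa [hrange] at h

/-- The simplicial complex of the faces, of all dimensions, of the elements in the ambient
space. -/
def complex : Geometry.SimplicialComplex ℝ (E d) :=
  complexOfFacets (M.emb '' M.elems)
    (forall_mem_image.2 fun _ => M.affineIndependent_emb)
    (forall_mem_image.2 fun p hp => forall_mem_image.2 fun q hq => by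
      rw [convexHull_emb, convexHull_emb, coe_emb, coe_emb]
      exact M.conforming _ _ _ (M.mem_elems.1 hp) _ (M.mem_elems.1 hq))

lemma mem_faces_complex : F ∈ M.complex.faces ↔ F.Nonempty ∧ ∃ p ∈ M.elems, F ⊆ M.emb p := by
  simp [complex, complexOfFacets]

lemma finite_faces_complex : M.complex.faces.Finite := by
  refine (M.elems.biUnion fun p => (M.emb p).powerset).finite_toSet.subset fun F hF => ?_
  simpa using (M.mem_faces_complex.1 hF).2

lemma emb_mem_faces_complex (hp : p ∈ M.elems) : M.emb p ∈ M.complex.faces :=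
  M.mem_faces_complex.2 ⟨Finset.card_pos.1 (by simp [M.card_emb hp]), p, hp, Subset.rfl⟩

lemma singleton_mem_faces_complex (hp : p ∈ M.elems) (hz : z ∈ M.emb p) :
    {z} ∈ M.complex.faces :=
  M.mem_faces_complex.2 ⟨Finset.singleton_nonempty z, p, hp, Finset.singleton_subset_iff.2 hz⟩

lemma mem_surf_iff : x ∈ G.surf i ↔
    ∃ K ∈ M.T i, x ∈ convexHull ℝ (M.emb ⟨i, K⟩ : Set (E d)) := by
  simp only [convexHull_emb, surf, ← M.cover i, image_iUnion₂, mem_iUnion₂, exists_prop]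

lemma surf_subset_space (i : Fin N) : G.surf i ⊆ M.complex.space := by
  intro x hx
  obtain ⟨K, hK, hxK⟩ := M.mem_surf_iff.1 hx
  exact Geometry.SimplicialComplex.convexHull_subset_space
    (M.emb_mem_faces_complex (p := ⟨i, K⟩) (M.mem_elems.2 hK)) hxK

lemma convexHull_emb_subset_surf (hp : p ∈ M.elems) :
    convexHull ℝ (M.emb p : Set (E d)) ⊆ G.surf p.1 :=
  fun _ hx => M.mem_surf_iff.2 ⟨p.2, M.mem_elems.1 hp, hx⟩

lemma mem_emb_of_mem_convexHull (hp : p ∈ M.elems) (hz : z ∈ M.emb p) (hq : q ∈ M.elems)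
    (h : z ∈ convexHull ℝ (M.emb q : Set (E d))) : z ∈ M.emb q :=
  Finset.singleton_subset_iff.1 (face_subset_of_mem_openSimplex
    (M.singleton_mem_faces_complex hp hz) (M.emb_mem_faces_complex hq)
    mem_openSimplex_singleton_self h)

lemma convexHull_inter_subset (hK : K ∈ M.T i) (hL : L ∈ M.T i) :
    convexHull ℝ (K : Set (E n)) ∩ convexHull ℝ (L : Set (E n)) ⊆
      convexHull ℝ (K ∩ L : Set (E n)) := by
  rintro x ⟨hxK, hxL⟩
  have hx := M.conforming i i K hK L hL ⟨mem_image_of_mem _ hxK, mem_image_of_mem _ hxL⟩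
  rw [← image_inter (G.Φ i).injective] at hx
  obtain ⟨y, hy, hxy⟩ := ((G.Φ i).toAffineMap.image_convexHull _).symm ▸ hx
  rwa [← (G.Φ i).injective hxy]

/-- The simplicial complex of the faces, of all dimensions, of the elements of domain `i` in the
coordinates of the domain. -/
def domainComplex (i : Fin N) : Geometry.SimplicialComplex ℝ (E n) :=
  complexOfFacets (M.T i) (M.indep i) fun _ hK _ hL => M.convexHull_inter_subset hK hL

lemma mem_faces_domainComplex {S : Finset (E n)} :
    S ∈ (M.domainComplex i).faces ↔ S.Nonempty ∧ ∃ K ∈ M.T i, S ⊆ K := Iff.rfl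

lemma finite_faces_domainComplex : (M.domainComplex i).faces.Finite := by
  refine ((M.T i).biUnion Finset.powerset).finite_toSet.subset fun S hS => ?_
  simpa using (M.mem_faces_domainComplex.1 hS).2

lemma mem_faces_domainComplex_of_mem (hK : K ∈ M.T i) : K ∈ (M.domainComplex i).faces :=
  M.mem_faces_domainComplex.2
    ⟨Finset.card_pos.1 (by simp [M.card_eq i K hK]), K, hK, Subset.rfl⟩

lemma space_domainComplex : (M.domainComplex i).space = closure (G.Ω i) := by
  rw [← M.cover i]
  refine Subset.antisymm (fun x hx => ?_) (iUnion₂_subset fun K hK =>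
    Geometry.SimplicialComplex.convexHull_subset_space (M.mem_faces_domainComplex_of_mem hK))
  obtain ⟨S, ⟨-, K, hK, hSK⟩, hxS⟩ := Geometry.SimplicialComplex.mem_space_iff.1 hx
  exact mem_iUnion₂.2 ⟨K, hK, convexHull_mono hSK hxS⟩

lemma interior_space_domainComplex : interior (M.domainComplex i).space = G.Ω i := by
  rw [space_domainComplex, (G.polytopal i).interior_closure]

lemma convexHull_subset_closure (hK : K ∈ M.T i) :
    convexHull ℝ (K : Set (E n)) ⊆ closure (G.Ω i) :=
  M.space_domainComplex ▸ Geometry.SimplicialComplex.convexHull_subset_space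
    (M.mem_faces_domainComplex_of_mem hK)

lemma interior_convexHull_subset (hK : K ∈ M.T i) :
    interior (convexHull ℝ (K : Set (E n))) ⊆ G.Ω i :=
  (G.polytopal i).interior_closure ▸ interior_mono (M.convexHull_subset_closure hK)

lemma nonempty_interior_convexHull (hK : K ∈ M.T i) :
    (interior (convexHull ℝ (K : Set (E n)))).Nonempty :=
  interior_convexHull_nonempty (M.indep i K hK) (by simpa using M.card_eq i K hK)

lemma exists_image_eq_of_mem_openSimplex (hF : F ∈ M.complex.faces) (hx : x ∈ openSimplex F)
    (hxi : x ∈ G.surf i) :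
    ∃ S ∈ (M.domainComplex i).faces, S.image (G.Φ i).toAffineMap = F := by
  obtain ⟨K, hK, hxK⟩ := M.mem_surf_iff.1 hxi
  have hKe : (⟨i, K⟩ : Elem n N) ∈ M.elems := M.mem_elems.2 hK
  obtain ⟨S, hSK, rfl⟩ := Finset.subset_image_iff.1
    (face_subset_of_mem_openSimplex hF (M.emb_mem_faces_complex hKe) hx hxK)
  exact ⟨S, M.mem_faces_domainComplex.2
    ⟨Finset.image_nonempty.1 (nonempty_of_mem_openSimplex hx), K, hK, hSK⟩, rfl⟩

lemma openSimplex_subset_image_frontier (hF : F ∈ M.complex.faces)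
    (h : (openSimplex F ∩ G.Φ i '' frontier (G.Ω i)).Nonempty) :
    openSimplex F ⊆ G.Φ i '' frontier (G.Ω i) := by
  obtain ⟨x, hxF, hx⟩ := h
  obtain ⟨S, hS, rfl⟩ :=
    M.exists_image_eq_of_mem_openSimplex hF hxF (image_mono frontier_subset_closure hx)
  rw [openSimplex_image (G.Φ i).injective] at hxF ⊢
  obtain ⟨x', hx', rfl⟩ := hx
  rw [AffineIsometry.coe_toAffineMap, (G.Φ i).injective.mem_set_image] at hxF
  refine image_mono fun y hy => ?_
  rw [(G.polytopal i).frontier_eq] at hx' ⊢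
  refine ⟨M.space_domainComplex ▸ Geometry.SimplicialComplex.convexHull_subset_space hS
    (openSimplex_subset_convexHull hy), fun hyΩ => hx'.2 ?_⟩
  rw [← M.interior_space_domainComplex] at hyΩ ⊢
  exact openSimplex_subset_interior_space M.finite_faces_domainComplex hS ⟨y, hy, hyΩ⟩ hxF

lemma card_le_of_mem_frontier (hF : F ∈ M.complex.faces) (hxF : x ∈ openSimplex F)
    (hx : x ∈ G.Φ i '' frontier (G.Ω i)) : F.card ≤ n := by
  obtain ⟨S, hS, rfl⟩ :=
    M.exists_image_eq_of_mem_openSimplex hF hxF (image_mono frontier_subset_closure hx)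
  rw [openSimplex_image (G.Φ i).injective] at hxF
  obtain ⟨x', hx', rfl⟩ := hx
  rw [AffineIsometry.coe_toAffineMap, (G.Φ i).injective.mem_set_image] at hxF
  rw [AffineIsometry.coe_toAffineMap, Finset.card_image_of_injective _ (G.Φ i).injective]
  obtain ⟨-, K, hK, hSK⟩ := M.mem_faces_domainComplex.1 hS
  have hSK' : S ≠ K := by
    rintro rfl
    rw [(G.polytopal i).frontier_eq] at hx'
    exact hx'.2 (M.interior_convexHull_subset hK
      (openSimplex_subset_interior_convexHull (M.nonempty_interior_convexHull hK) hxF))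
  exact Nat.lt_succ_iff.1
    ((Finset.card_lt_card (hSK.ssubset_of_ne hSK')).trans_eq (M.card_eq i K hK))

lemma convexHull_subset_of_mem_Γ (hF : F ∈ M.complex.faces) (hγ : γ ∈ G.Γ)
    (h : (openSimplex F ∩ γ).Nonempty) : convexHull ℝ (F : Set (E d)) ⊆ γ := by
  obtain ⟨x, hxF, hxγ⟩ := h
  refine convexHull_min ?_ (G.convex_of_mem_Γ hγ)
  rw [G.bif_eq γ hγ]
  refine subset_iInter₂ fun i hi => ?_
  obtain ⟨K, hK, hxK⟩ := M.mem_surf_iff.1 (show x ∈ G.surf i from hi hxγ)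
  have hKe : (⟨i, K⟩ : Elem n N) ∈ M.elems := M.mem_elems.2 hK
  exact (Finset.coe_subset.2 (face_subset_of_mem_openSimplex hF (M.emb_mem_faces_complex hKe)
    hxF hxK)).trans ((subset_convexHull ℝ _).trans (M.convexHull_emb_subset_surf hKe))

lemma openSimplex_subset_outerFrontier (hF : F ∈ M.complex.faces)
    (h : (openSimplex F ∩ G.outerFrontier).Nonempty) : openSimplex F ⊆ G.outerFrontier := by
  obtain ⟨x, hxF, hx, hxΓ⟩ := h
  obtain ⟨i, hxi⟩ := mem_iUnion.1 hx
  refine fun y hy =>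
    ⟨mem_iUnion.2 ⟨i, M.openSimplex_subset_image_frontier hF ⟨x, hxF, hxi⟩ hy⟩, fun hyΓ => hxΓ ?_⟩
  obtain ⟨γ, hγ, hyγ⟩ := mem_iUnion₂.1 hyΓ
  exact mem_iUnion₂.2 ⟨γ, hγ, M.convexHull_subset_of_mem_Γ hF hγ ⟨y, hy, hyγ⟩
    (openSimplex_subset_convexHull hxF)⟩

lemma convexHull_subset_boundary (hF : F ∈ M.complex.faces)
    (h : (openSimplex F ∩ G.boundary).Nonempty) : convexHull ℝ (F : Set (E d)) ⊆ G.boundary := by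
  obtain ⟨z, hzF, hz⟩ := h
  obtain ⟨x, hx, hxF⟩ := ((mem_closure_iff_frequently.1 hz).and_eventually
    (eventually_face_subset M.finite_faces_complex hF hzF)).exists
  obtain ⟨i, hxi⟩ := mem_iUnion.1 hx.1
  obtain ⟨S, hS, hxS⟩ := exists_face_mem_openSimplex
    (M.surf_subset_space i (image_mono frontier_subset_closure hxi))
  have hFS := hxF S hS (openSimplex_subset_convexHull hxS)
  calc convexHull ℝ (F : Set (E d)) ⊆ convexHull ℝ (S : Set (E d)) :=
        convexHull_mono (Finset.coe_subset.2 hFS)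
    _ ⊆ closure (openSimplex S) := convexHull_subset_closure_openSimplex hxS
    _ ⊆ G.boundary := closure_mono (M.openSimplex_subset_outerFrontier hS ⟨x, hxS, hx⟩)

/-! ### Chains of elements at a vertex -/

lemma mem_patch : p ∈ M.patch z ↔ p ∈ M.elems ∧ z ∈ M.emb p := by
  simp [patch]

lemma mem_faces : F ∈ M.faces ↔ ∃ p ∈ M.elems, F ⊆ M.emb p ∧ F.card = n := by
  simp [faces, Finset.mem_powersetCard]

lemma mem_elemsAt : K ∈ M.elemsAt i F ↔ K ∈ M.T i ∧ F ⊆ M.emb ⟨i, K⟩ := by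
  simp [elemsAt]

lemma exists_face_of_mem_closure (hn : n = 1 ∨ n = 2) (hp : p ∈ M.patch z) {A : Set (E d)}
    (hA : A ⊆ ⋃ i, G.Φ i '' frontier (G.Ω i)) (hperfect : 1 < n → Preperfect A)
    (hz : z ∈ closure A) : ∃ x ∈ A, ∃ F ∈ M.faces, z ∈ F ∧ x ∈ openSimplex F := by
  have hfreq : ∃ᶠ x in 𝓝 z, x ∈ A ∧ (1 < n → x ≠ z) := by
    by_cases h1n : 1 < n
    · rw [closure_eq_self_union_derivedSet] at hz
      have hacc : AccPt z (𝓟 A) := hz.elim (hperfect h1n z) id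
      exact (accPt_iff_frequently.1 hacc).mono fun x hx => ⟨hx.2, fun _ => hx.1⟩
    · exact (mem_closure_iff_frequently.1 hz).mono fun x hx => ⟨hx, fun h => absurd h h1n⟩
  rw [mem_patch] at hp
  obtain ⟨x, ⟨hxA, hxz⟩, hx⟩ := (hfreq.and_eventually (eventually_face_subset
    M.finite_faces_complex (M.singleton_mem_faces_complex hp.1 hp.2)
    mem_openSimplex_singleton_self)).exists
  obtain ⟨i, hxi⟩ := mem_iUnion.1 (hA hxA)
  obtain ⟨F, hF, hxF⟩ := exists_face_mem_openSimplex
    (M.surf_subset_space i (image_mono frontier_subset_closure hxi))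
  have hzF := Finset.singleton_subset_iff.1 (hx F hF (openSimplex_subset_convexHull hxF))
  have hle : F.card ≤ n := M.card_le_of_mem_frontier hF hxF hxi
  have hge : n ≤ F.card := by
    rcases hn with rfl | rfl
    · exact Finset.card_pos.2 ⟨z, hzF⟩
    · exact two_le_card_of_mem_convexHull hzF (openSimplex_subset_convexHull hxF)
        (hxz one_lt_two)
  obtain ⟨-, q, hq, hFq⟩ := M.mem_faces_complex.1 hF
  exact ⟨x, hxA, F, M.mem_faces.2 ⟨q, hq, hFq, hle.antisymm hge⟩, hzF, hxF⟩

lemma mem_faces_complex_of_mem_faces (hF : F ∈ M.faces) (hz : z ∈ F) : F ∈ M.complex.faces := by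
  obtain ⟨p, hp, hFp, -⟩ := M.mem_faces.1 hF
  exact M.mem_faces_complex.2 ⟨⟨z, hz⟩, p, hp, hFp⟩

/-- Two elements with the vertex `z` share a face at `z` across which the jump is penalized: a
face inside a domain or on a bifurcation. -/
def Linked (z : E d) (p q : Elem n N) : Prop :=
  p ∈ M.patch z ∧ q ∈ M.patch z ∧ ∃ F ∈ M.faces, z ∈ F ∧ F ⊆ M.emb p ∧ F ⊆ M.emb q ∧
    (p.1 = q.1 ∨ ∃ γ ∈ G.Γ, convexHull ℝ (F : Set (E d)) ⊆ γ ∧ p.1 ∈ G.I γ ∧ q.1 ∈ G.I γ)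

/-- Around a vertex, a domain stays connected without the vertex, so one can walk from element to
element through common points other than the vertex. -/
lemma reflTransGen_inter_of_mem (hn : 1 < n) {y : E n} (hK : K ∈ M.T i) (hyK : y ∈ K)
    (hL : L ∈ M.T i) (hyL : y ∈ L) :
    Relation.ReflTransGen (fun A B => A ∈ M.T i ∧ B ∈ M.T i ∧ y ∈ A ∩ B ∧
      ∃ x ≠ y, x ∈ convexHull ℝ (A ∩ B : Set (E n))) K L := by
  have hyC : {y} ∈ (M.domainComplex i).faces := M.mem_faces_domainComplex.2
    ⟨Finset.singleton_nonempty y, K, hK, Finset.singleton_subset_iff.2 hyK⟩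
  obtain ⟨ε, hε, hnear⟩ := Metric.eventually_nhds_iff_ball.1 (eventually_face_subset
    M.finite_faces_domainComplex hyC mem_openSimplex_singleton_self)
  have hyΩ := M.convexHull_subset_closure hK (subset_convexHull ℝ _ hyK)
  obtain ⟨r, hpre, hr, hrε⟩ := (((G.polytopal i).eventually_isPreconnected_inter_ball_diff hn
    hyΩ).and (Ioo_mem_nhdsGT hε)).exists
  have hmeet : ∀ K ∈ (M.T i).filter (y ∈ ·),
      (((G.Ω i ∩ Metric.ball y r) \ {y}) ∩ convexHull ℝ (K : Set (E n))).Nonempty := by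
    intro K hK
    obtain ⟨hKT, hyK⟩ := Finset.mem_filter.1 hK
    have hcl : y ∈ closure (interior (convexHull ℝ (K : Set (E n)))) := by
      rw [(convex_convexHull ℝ _).closure_interior_eq_closure_of_nonempty_interior
        (M.nonempty_interior_convexHull hKT)]
      exact subset_closure (subset_convexHull ℝ _ hyK)
    have : Nontrivial (E n) := Module.nontrivial_of_finrank_pos (R := ℝ) (by simp; omega)
    obtain ⟨x, ⟨hx, hxr⟩, hxy⟩ := (dense_compl_singleton y).inter_open_nonempty
      _ (isOpen_interior.inter Metric.isOpen_ball)
      (mem_closure_iff_nhds'.1 hcl _ (Metric.ball_mem_nhds y hr) |>.elim fun w hw => ⟨w, w.2, hw⟩)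
    exact ⟨x, ⟨⟨M.interior_convexHull_subset hKT hx, hxr⟩, hxy⟩, interior_subset hx⟩
  have hcover : (G.Ω i ∩ Metric.ball y r) \ {y} ⊆
      ⋃ K ∈ (M.T i).filter (y ∈ ·), convexHull ℝ (K : Set (E n)) := by
    intro x hx
    obtain ⟨K, hK, hxK⟩ := mem_iUnion₂.1 (M.cover i ▸ subset_closure hx.1.1)
    have hyK := hnear x (Metric.ball_subset_ball hrε.le hx.1.2) K
      (M.mem_faces_domainComplex_of_mem hK) hxK
    exact mem_iUnion₂.2 ⟨K, Finset.mem_filter.2 ⟨hK, Finset.singleton_subset_iff.1 hyK⟩, hxK⟩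
  refine Relation.ReflTransGen.mono ?_ _ _ (reflTransGen_inter_of_isPreconnected hpre
    (fun K _ => K.finite_toSet.isClosed_convexHull ℝ) hcover hmeet
    (Finset.mem_filter.2 ⟨hK, hyK⟩) (Finset.mem_filter.2 ⟨hL, hyL⟩))
  rintro A B ⟨hA, hB, x, hxU, hx⟩
  rw [Finset.mem_filter] at hA hB
  exact ⟨hA.1, hB.1, Finset.mem_inter.2 ⟨hA.2, hB.2⟩, x, hxU.2,
    M.convexHull_inter_subset hA.1 hB.1 hx⟩

lemma linked_of_card_le {y : E n} (hn : 0 < n) (hK : K ∈ M.T i) (hL : L ∈ M.T i)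
    (hy : y ∈ K ∩ L) (hcard : n ≤ (K ∩ L).card) : M.Linked (G.Φ i y) ⟨i, K⟩ ⟨i, L⟩ := by
  obtain ⟨F, hyF, hF, hFn⟩ := Finset.exists_subsuperset_card_eq
    (Finset.singleton_subset_iff.2 hy) ((Finset.card_singleton y).trans_le hn) hcard
  have hFK := Finset.image_subset_image (f := G.Φ i) (hF.trans Finset.inter_subset_left)
  have hFL := Finset.image_subset_image (f := G.Φ i) (hF.trans Finset.inter_subset_right)
  have hyF' := Finset.mem_image_of_mem (G.Φ i) (Finset.singleton_subset_iff.1 hyF)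
  have hKe : (⟨i, K⟩ : Elem n N) ∈ M.elems := M.mem_elems.2 hK
  exact ⟨M.mem_patch.2 ⟨hKe, hFK hyF'⟩, M.mem_patch.2 ⟨M.mem_elems.2 hL, hFL hyF'⟩,
    F.image (G.Φ i), M.mem_faces.2 ⟨⟨i, K⟩, hKe, hFK,
      by rw [Finset.card_image_of_injective _ (G.Φ i).injective, hFn]⟩, hyF', hFK, hFL, Or.inl rfl⟩

lemma reflTransGen_linked_of_same_domain (hn : n = 1 ∨ n = 2) (hK : ⟨i, K⟩ ∈ M.patch z)
    (hL : ⟨i, L⟩ ∈ M.patch z) : Relation.ReflTransGen (M.Linked z) ⟨i, K⟩ ⟨i, L⟩ := by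
  obtain ⟨hKT, hzK⟩ := M.mem_patch.1 hK
  obtain ⟨hLT, hzL⟩ := M.mem_patch.1 hL
  obtain ⟨y, hyK, rfl⟩ := Finset.mem_image.1 hzK
  have hyL : y ∈ L := M.apply_mem_emb.1 hzL
  rw [mem_elems] at hKT hLT
  rcases hn with rfl | rfl
  · have hy := Finset.mem_inter.2 ⟨hyK, hyL⟩
    exact .single (M.linked_of_card_le one_pos hKT hLT hy (Finset.card_pos.2 ⟨y, hy⟩))
  · refine Relation.ReflTransGen.lift (fun K => (⟨i, K⟩ : Elem 2 N)) ?_ _ _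
      (M.reflTransGen_inter_of_mem one_lt_two hKT hyK hLT hyL)
    rintro A B ⟨hA, hB, hy, x, hxy, hx⟩
    rw [← Finset.coe_inter] at hx
    exact M.linked_of_card_le two_pos hA hB hy (two_le_card_of_mem_convexHull hy hx hxy)

lemma reflTransGen_linked_of_mem_Γ (hn : n = 1 ∨ n = 2) (hγ : γ ∈ G.Γ) (hz : z ∈ γ)
    (hp : p ∈ M.patch z) (hq : q ∈ M.patch z) (hpγ : γ ⊆ G.surf p.1) (hqγ : γ ⊆ G.surf q.1) :
    Relation.ReflTransGen (M.Linked z) p q := by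
  obtain ⟨x, hxγ, F, hF, hzF, hxF⟩ := M.exists_face_of_mem_closure hn hp
    ((G.bif_frontier γ hγ _ hpγ).trans (subset_iUnion (fun i => G.Φ i '' frontier (G.Ω i)) p.1))
    (G.preperfect_of_mem_Γ · hγ) (subset_closure hz)
  have hFC := M.mem_faces_complex_of_mem_faces hF hzF
  have hsub : ∀ i, γ ⊆ G.surf i → ∃ K, (⟨i, K⟩ : Elem n N) ∈ M.patch z ∧ F ⊆ M.emb ⟨i, K⟩ := by
    intro i hi
    obtain ⟨K, hK, hxK⟩ := M.mem_surf_iff.1 (hi hxγ)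
    have hKe : (⟨i, K⟩ : Elem n N) ∈ M.elems := M.mem_elems.2 hK
    have hFK := face_subset_of_mem_openSimplex hFC (M.emb_mem_faces_complex hKe) hxF hxK
    exact ⟨K, M.mem_patch.2 ⟨hKe, hFK hzF⟩, hFK⟩
  obtain ⟨K, hK, hFK⟩ := hsub p.1 hpγ
  obtain ⟨L, hL, hFL⟩ := hsub q.1 hqγ
  have hlink : M.Linked z ⟨p.1, K⟩ ⟨q.1, L⟩ := ⟨hK, hL, F, hF, hzF, hFK, hFL, Or.inr ⟨γ, hγ,
    M.convexHull_subset_of_mem_Γ hFC hγ ⟨x, hxF, hxγ⟩, G.mem_I.2 hpγ, G.mem_I.2 hqγ⟩⟩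
  exact ((M.reflTransGen_linked_of_same_domain hn hp hK).tail hlink).trans
    (M.reflTransGen_linked_of_same_domain hn hL hq)

lemma reflTransGen_linked (hn : n = 1 ∨ n = 2) (hp : p ∈ M.patch z) (hq : q ∈ M.patch z) :
    Relation.ReflTransGen (M.Linked z) p q := by
  have hsurf : ∀ {p}, p ∈ M.patch z → z ∈ G.surf p.1 := fun hp =>
    M.convexHull_emb_subset_surf (M.mem_patch.1 hp).1
      (subset_convexHull ℝ _ (M.mem_patch.1 hp).2)
  obtain ⟨j, L⟩ := q
  induction G.meet z p.1 j (hsurf hp) (hsurf hq) generalizing L with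
  | refl => exact M.reflTransGen_linked_of_same_domain hn hp hq
  | tail _ hγ ih =>
    obtain ⟨γ, hγ, hzγ, haγ, hbγ⟩ := hγ
    obtain ⟨K, hK, hzK⟩ := M.mem_surf_iff.1 (haγ hzγ)
    have hKe : (⟨_, K⟩ : Elem n N) ∈ M.elems := M.mem_elems.2 hK
    have hKz := M.mem_patch.2 ⟨hKe, M.mem_emb_of_mem_convexHull (M.mem_patch.1 hp).1
      (M.mem_patch.1 hp).2 hKe hzK⟩
    exact (ih K hKz).trans (M.reflTransGen_linked_of_mem_Γ hn hγ hzγ hKz hq haγ hbγ)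

lemma exists_mem_bdFaces (hn : n = 1 ∨ n = 2) (hp : p ∈ M.patch z) (hz : z ∈ G.boundary) :
    ∃ q ∈ M.patch z, ∃ F ∈ M.bdFaces q.1, z ∈ F ∧ F ⊆ M.emb q := by
  obtain ⟨x, hx, F, hF, hzF, hxF⟩ :=
    M.exists_face_of_mem_closure hn hp sdiff_subset G.preperfect_outerFrontier hz
  have hFb := M.convexHull_subset_boundary (M.mem_faces_complex_of_mem_faces hF hzF)
    ⟨x, hxF, subset_closure hx⟩
  obtain ⟨q, hq, hFq, -⟩ := M.mem_faces.1 hF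
  exact ⟨q, M.mem_patch.2 ⟨hq, hFq hzF⟩, F, Finset.mem_filter.2
    ⟨hF, ⟨q.2, M.mem_elemsAt.2 ⟨M.mem_elems.1 hq, hFq⟩⟩, hFb⟩, hzF, hFq⟩

end Mesh

end Network

/-! ### Weak gradients of Lipschitz functions -/

lemma lipschitzOnWith_of_closed_cover {V Y ι : Type*} [NormedAddCommGroup V] [NormedSpace ℝ V]
    [PseudoMetricSpace Y] [Finite ι] {s : Set V} (hs : Convex ℝ s) {A : ι → Set V}
    (hA : ∀ i, IsClosed (A i)) (hcov : s ⊆ ⋃ i, A i) {f : V → Y} {C : NNReal}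
    (hf : ∀ i, LipschitzOnWith C f (A i)) : LipschitzOnWith C f s := by
  have hcont : ContinuousOn f s :=
    ((locallyFinite_of_finite A).continuousOn_iUnion hA fun i => (hf i).continuousOn).mono hcov
  refine LipschitzOnWith.of_dist_le_mul fun x hx y hy => ?_
  have hmaps : MapsTo (AffineMap.lineMap x y) (Icc (0 : ℝ) 1) s := fun t ht =>
    hs.lineMap_mem hx hy ht
  have hline : Continuous (AffineMap.lineMap x y : ℝ → V) := AffineMap.lineMap_continuous
  let good : Set ℝ :=
    {t | dist (f x) (f (AffineMap.lineMap x y t)) ≤ C * (t * dist x y)}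
  suffices Icc 0 1 ⊆ good by simpa [good] using this (right_mem_Icc.2 zero_le_one)
  refine IsClosed.Icc_subset_of_forall_exists_gt ?_ (by simp [good]) fun t ht r hr => ?_
  · rw [inter_comm]
    exact isClosed_Icc.isClosed_le
      (continuous_dist.comp_continuousOn
        (continuousOn_const.prodMk (hcont.comp hline.continuousOn hmaps)))
      (by fun_prop)
  have hnext : ∀ᶠ u in 𝓝[>] t, u ∈ Ioc t (min r 1) := Ioc_mem_nhdsGT (lt_min hr ht.2.2)
  obtain ⟨i, hi⟩ : ∃ i, ∃ᶠ u in 𝓝[>] t, AffineMap.lineMap x y u ∈ A i := by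
    refine frequently_exists.1 (hnext.frequently.mono fun u hu => ?_)
    exact mem_iUnion.1 <| hcov <|
      hmaps ⟨(ht.2.1.trans_lt hu.1).le, hu.2.trans (min_le_right _ _)⟩
  have hti : AffineMap.lineMap x y t ∈ A i :=
    ((hA i).preimage hline).closure_subset
      (mem_closure_iff_frequently.2 (hi.filter_mono nhdsWithin_le_nhds))
  obtain ⟨u, hui, hu⟩ := (hi.and_eventually hnext).exists
  refine ⟨u, ?_, hu.1, hu.2.trans (min_le_left _ _)⟩
  calc dist (f x) (f (AffineMap.lineMap x y u))
      ≤ C * (t * dist x y) + C * ((u - t) * dist x y) := by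
        refine (dist_triangle _ _ _).trans (add_le_add ht.1 ?_)
        refine ((hf i).dist_le_mul _ hti _ hui).trans_eq ?_
        rw [dist_comm, dist_lineMap_lineMap, Real.dist_eq, abs_of_pos (sub_pos.2 hu.1)]
    _ = C * (u * dist x y) := by ring

section Gradient

variable {V : Type*} [NormedAddCommGroup V] [InnerProductSpace ℝ V] [FiniteDimensional ℝ V]

lemma norm_gradient_le_of_lipschitzOnWith {f : V → ℝ} {C : NNReal} {s : Set V} {x : V}
    (hs : s ∈ 𝓝 x) (hf : LipschitzOnWith C f s) : ‖∇ f x‖ ≤ C := by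
  rw [gradient, LinearIsometryEquiv.norm_map]
  exact norm_fderiv_le_of_lipschitzOn ℝ hs hf

variable [MeasurableSpace V] [BorelSpace V]

lemma measurable_gradient (f : V → ℝ) : Measurable (∇ f) :=
  (InnerProductSpace.toDual ℝ V).symm.continuous.measurable.comp (measurable_fderiv ℝ f)

lemma locallyIntegrableOn_gradient (μ : Measure V) [IsLocallyFiniteMeasure μ] {Ω : Set V}
    (hΩ : IsOpen Ω) {f : V → ℝ} (hf : LocallyLipschitzOn Ω f) :
    LocallyIntegrableOn (∇ f) Ω μ := by
  intro x hx
  obtain ⟨C, U, hU, hfU⟩ := hf hx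
  rw [hΩ.nhdsWithin_eq hx] at hU ⊢
  refine (μ.finiteAt_nhds x).integrableAtFilter
    ⟨univ, univ_mem, (measurable_gradient f).stronglyMeasurable.aestronglyMeasurable⟩ ⟨C, ?_⟩
  rw [eventually_map]
  filter_upwards [eventually_mem_nhds_iff.2 hU] with y hy
  exact norm_gradient_le_of_lipschitzOnWith hy hfU

lemma integral_smul_gradient_of_lipschitzWith (μ : Measure V) [μ.IsAddHaarMeasure] {f φ : V → ℝ}
    {C : NNReal} (hf : LipschitzWith C f) (hφ : ContDiff ℝ 1 φ) (hc : HasCompactSupport φ) :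
    ∫ x, f x • ∇ φ x ∂μ = -∫ x, φ x • ∇ f x ∂μ := by
  have hφ' : Continuous (∇ φ) :=
    (InnerProductSpace.toDual ℝ V).symm.continuous.comp (hφ.continuous_fderiv one_ne_zero)
  have hc' : HasCompactSupport (∇ φ) := (hc.fderiv ℝ).comp_left (map_zero _)
  have hint : Integrable (fun x => f x • ∇ φ x) μ :=
    (hf.continuous.smul hφ').integrable_of_hasCompactSupport hc'.smul_left
  have hint' : Integrable (fun x => φ x • ∇ f x) μ := by
    refine LocallyIntegrable.integrable_smul_left_of_hasCompactSupport ?_ hφ.continuous hc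
    refine locallyIntegrableOn_univ.1 (locallyIntegrableOn_gradient μ isOpen_univ fun x _ => ?_)
    exact ⟨C, univ, univ_mem, hf.lipschitzOnWith⟩
  obtain ⟨D, hD⟩ := hφ.lipschitzWith_of_hasCompactSupport hc one_ne_zero
  refine ext_inner_left ℝ fun v => ?_
  rw [inner_neg_right, ← integral_inner hint v, ← integral_inner hint' v, ← integral_neg]
  have hleft (x : V) : inner ℝ v (f x • ∇ φ x) = -(lineDeriv ℝ φ x (-v) * f x) := by
    rw [lineDeriv_neg, (hφ.differentiable one_ne_zero x).lineDeriv_eq_fderiv, inner_smul_right,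
      inner_gradient_right, conj_trivial]
    ring
  have hright : ∀ᵐ x ∂μ, lineDeriv ℝ f x v * φ x = inner ℝ v (φ x • ∇ f x) := by
    filter_upwards [hf.ae_differentiableAt] with x hx
    rw [hx.lineDeriv_eq_fderiv, inner_smul_right, inner_gradient_right, conj_trivial, mul_comm]
  simp_rw [hleft, integral_neg, ← hf.integral_lineDeriv_mul_eq hD hc v, integral_congr_ae hright]

end Gradient

section WeakGradient

variable {n : ℕ} {Ω : Set (E n)} {w : E n → ℝ}

lemma hasWeakGradient_of_locallyLipschitzOn (hΩ : IsOpen Ω) (hw : LocallyLipschitzOn Ω w) :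
    HasWeakGradient Ω w (∇ w) := by
  refine ⟨hw.continuousOn.locallyIntegrableOn hΩ.measurableSet,
    locallyIntegrableOn_gradient volume hΩ hw, fun φ hφ hφc hφΩ => ?_⟩
  obtain ⟨K, hK, hφK, hKΩ⟩ := exists_compact_between hφc hΩ hφΩ
  obtain ⟨C, hC⟩ := (hw.mono hKΩ).exists_lipschitzOnWith_of_compact hK
  obtain ⟨f, hf, hwf⟩ := hC.extend_real
  have hgrad {x : E n} (hx : x ∈ tsupport φ) : ∇ w x = ∇ f x := by
    refine EventuallyEq.gradient_eq ?_
    filter_upwards [mem_interior_iff_mem_nhds.1 (hφK hx)] with y hy using hwf hy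
  have hφ0 {x : E n} (hx : x ∉ tsupport φ) : φ x = 0 := image_eq_zero_of_notMem_tsupport hx
  have hφ0' {x : E n} (hx : x ∉ tsupport φ) : ∇ φ x = 0 := by
    rw [gradient, fderiv_of_notMem_tsupport ℝ hx, map_zero]
  rw [setIntegral_eq_integral_of_forall_compl_eq_zero fun x hx => by
      rw [hφ0' fun h => hx (hφΩ h), smul_zero],
    setIntegral_eq_integral_of_forall_compl_eq_zero fun x hx => by
      rw [hφ0 fun h => hx (hφΩ h), zero_smul]]
  calc ∫ x, w x • ∇ φ x = ∫ x, f x • ∇ φ x := by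
        congr with x
        by_cases hx : x ∈ tsupport φ
        · rw [hwf (interior_subset (hφK hx))]
        · rw [hφ0' hx, smul_zero, smul_zero]
    _ = -∫ x, φ x • ∇ f x :=
        integral_smul_gradient_of_lipschitzWith volume hf (hφ.of_le (by simp)) hφc
    _ = -∫ x, φ x • ∇ w x := by
        congr with x
        by_cases hx : x ∈ tsupport φ
        · rw [hgrad hx]
        · rw [hφ0 hx, zero_smul, zero_smul]

lemma HasWeakGradient.ae_eq (hΩ : IsOpen Ω) {W W' : E n → E n} (h : HasWeakGradient Ω w W)
    (h' : HasWeakGradient Ω w W') : W =ᵐ[volume.restrict Ω] W' := by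
  rw [EventuallyEq, ae_restrict_iff' hΩ.measurableSet]
  suffices ∀ᵐ x : E n, x ∈ Ω → W x - W' x = 0 by simpa only [sub_eq_zero] using this
  refine hΩ.ae_eq_zero_of_integral_contDiff_smul_eq_zero (h.2.1.sub h'.2.1)
    fun φ hφ hφc hφΩ => ?_
  have hint (U : E n → E n) (hU : LocallyIntegrableOn U Ω) :
      IntegrableOn (fun x => φ x • U x) Ω := by
    have hsupp : Function.support (fun x => φ x • U x) ⊆ tsupport φ :=
      (Function.support_smul_subset_left φ U).trans subset_closure
    refine ((integrableOn_iff_integrable_of_support_subset hsupp).1 ?_).integrableOn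
    exact (hU.integrableOn_compact_subset hφΩ hφc).continuousOn_smul hφ.continuous.continuousOn hφc
  rw [← setIntegral_eq_integral_of_forall_compl_eq_zero (s := Ω) fun x hx => by
    rw [image_eq_zero_of_notMem_tsupport fun h => hx (hφΩ h), zero_smul]]
  simp_rw [smul_sub]
  rw [integral_sub (hint W h.2.1) (hint W' h'.2.1), sub_eq_zero, ← neg_inj,
    ← h.2.2 φ hφ hφc hφΩ, h'.2.2 φ hφ hφc hφΩ]

lemma HasWeakGradient.weakGrad_ae_eq (hΩ : IsOpen Ω) {W : E n → E n}
    (h : HasWeakGradient Ω w W) : weakGrad Ω w =ᵐ[volume.restrict Ω] W := by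
  have hex : ∃ W, HasWeakGradient Ω w W := ⟨W, h⟩
  rw [weakGrad, dif_pos hex]
  exact hex.choose_spec.ae_eq hΩ h

end WeakGradient

/-! ### Piecewise Lipschitz and affine functions -/

lemma exists_lipschitzOnWith_nhds_of_closed_cover {V Y ι : Type*} [NormedAddCommGroup V]
    [NormedSpace ℝ V] [PseudoMetricSpace Y] [Finite ι] {Ω : Set V} (hΩ : IsOpen Ω)
    {A : ι → Set V} (hA : ∀ i, IsClosed (A i)) (hcov : Ω ⊆ ⋃ i, A i) {f : V → Y}
    (hf : ∀ i, ∃ C, LipschitzOnWith C f (A i)) :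
    ∃ C, ∀ x ∈ Ω, ∃ U ∈ 𝓝 x, LipschitzOnWith C f U := by
  cases nonempty_fintype ι
  choose C hC using hf
  refine ⟨∑ i, C i, fun x hx => ?_⟩
  obtain ⟨r, hr, hball⟩ := Metric.isOpen_iff.1 hΩ x hx
  refine ⟨_, Metric.ball_mem_nhds x hr, lipschitzOnWith_of_closed_cover (convex_ball x r) hA
    (hball.trans hcov) fun i => (hC i).weaken ?_⟩
  exact Finset.single_le_sum (f := C) (fun _ _ => zero_le) (Finset.mem_univ i)

lemma memLp_restrict_of_continuousOn_isCompact {X : Type*} [TopologicalSpace X]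
    [MeasurableSpace X] [OpensMeasurableSpace X] {μ : Measure X} {s K : Set X}
    (hs : MeasurableSet s) (hsK : s ⊆ K) (hK : IsCompact K) (hμ : μ s < ⊤) {f : X → ℝ}
    (hf : ContinuousOn f K) (p : ENNReal) : MemLp f p (μ.restrict s) := by
  have : IsFiniteMeasure (μ.restrict s) := ⟨by rwa [Measure.restrict_apply_univ]⟩
  obtain ⟨C, hC⟩ := hK.exists_bound_of_continuousOn hf
  exact MemLp.of_bound ((hf.mono hsK).aestronglyMeasurable hs) C
    (ae_restrict_of_forall_mem hs fun x hx => hC x (hsK hx))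

section Affine

variable {V : Type*} [NormedAddCommGroup V] [InnerProductSpace ℝ V] [FiniteDimensional ℝ V]

/-- The gradient of an affine function. -/
def affineGrad (p : V →ᵃ[ℝ] ℝ) : V :=
  (InnerProductSpace.toDual ℝ V).symm (LinearMap.toContinuousLinearMap p.linear)

lemma inner_affineGrad (p : V →ᵃ[ℝ] ℝ) (u : V) : inner ℝ (affineGrad p) u = p.linear u := by
  rw [affineGrad, InnerProductSpace.toDual_symm_apply, LinearMap.coe_toContinuousLinearMap']

lemma gradient_affineMap (p : V →ᵃ[ℝ] ℝ) (x : V) : ∇ (p : V → ℝ) x = affineGrad p := by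
  refine HasGradientAt.gradient ?_
  rw [hasGradientAt_iff_hasFDerivAt, affineGrad, LinearIsometryEquiv.apply_symm_apply]
  exact (⟨p, p.continuous_of_finiteDimensional⟩ : V →ᴬ[ℝ] ℝ).hasFDerivAt

end Affine

lemma affineMap_sum_apply {V ι : Type*} [AddCommGroup V] [Module ℝ V] (s : Finset ι)
    (f : ι → V →ᵃ[ℝ] ℝ) (x : V) : (∑ a ∈ s, f a) x = ∑ a ∈ s, f a x :=
  map_sum (⟨⟨fun p => p x, rfl⟩, fun _ _ => rfl⟩ : (V →ᵃ[ℝ] ℝ) →+ ℝ) f s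

lemma exists_affineMap_apply_eq {V ι : Type*} [AddCommGroup V] [Module ℝ V] [Finite ι]
    (b : AffineBasis ι ℝ V) (c : ι → ℝ) : ∃ p : V →ᵃ[ℝ] ℝ, ∀ a, p (b a) = c a := by
  cases nonempty_fintype ι
  exact ⟨∑ a, c a • b.coord a, fun a => by simp [affineMap_sum_apply, b.coord_apply]⟩

section Element

variable {n : ℕ} {w : E n → ℝ} {K : Finset (E n)} {p q : E n →ᵃ[ℝ] ℝ}

lemma agreesOn_elemPoly (h : ∃ p, AgreesOn w K p) : AgreesOn w K (elemPoly w K) := by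
  rw [elemPoly, dif_pos h]
  exact h.choose_spec

lemma AgreesOn.unique (hK : (interior (convexHull ℝ (K : Set (E n)))).Nonempty)
    (hp : AgreesOn w K p) (hq : AgreesOn w K q) : p = q := by
  have hae : p =ᵐ[volume.restrict (interior (convexHull ℝ (K : Set (E n))))] q :=
    ae_restrict_of_ae_restrict_of_subset interior_subset (hp.symm.trans hq)
  exact AffineMap.ext_on (isOpen_interior.affineSpan_eq_top hK) <|
    Measure.eqOn_open_of_ae_eq hae isOpen_interior
      p.continuous_of_finiteDimensional.continuousOn q.continuous_of_finiteDimensional.continuousOn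

lemma elemPoly_eq (hK : (interior (convexHull ℝ (K : Set (E n)))).Nonempty)
    (hp : AgreesOn w K p) : elemPoly w K = p :=
  (agreesOn_elemPoly ⟨p, hp⟩).unique hK hp

end Element

/-! ### The enriched function -/

lemma hausdorffMeasure_convexHull_lt_top {n k : ℕ} (hn : n = 1 ∨ n = 2) {S : Finset (E k)}
    (hS : S.card = n) : μH[(n : ℝ) - 1] (convexHull ℝ (S : Set (E k))) < ⊤ := by
  rcases hn with rfl | rfl
  · obtain ⟨a, rfl⟩ := Finset.card_eq_one.1 hS
    simp
  · obtain ⟨a, b, -, rfl⟩ := Finset.card_eq_two.1 hS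
    have hdim : ((2 : ℕ) : ℝ) - 1 = 1 := by norm_num
    rw [hdim, Finset.coe_pair, convexHull_pair, hausdorffMeasure_segment]
    exact edist_lt_top a b

namespace Network.Mesh

variable {n d N : ℕ} {G : Network n d N} (M : G.Mesh) {i j : Fin N} {K : Finset (E n)}
  {x y : E n} {z : E d} {p q : Elem n N}

lemma exists_mem_convexHull_of_mem_closure (hx : x ∈ closure (G.Ω i)) :
    ∃ K ∈ M.T i, x ∈ convexHull ℝ (K : Set (E n)) := by
  simpa only [← M.cover i, mem_iUnion₂, exists_prop] using hx

include M in
lemma hausdorffMeasure_frontier_lt_top (hn : n = 1 ∨ n = 2) (i : Fin N) :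
    μH[(n : ℝ) - 1] (frontier (G.Ω i)) < ⊤ := by
  have hpos : 0 ≤ (n : ℝ) - 1 ∨ Function.Surjective (G.Φ i) := by
    rcases hn with rfl | rfl <;> norm_num
  rw [← (G.Φ i).isometry.hausdorffMeasure_image hpos]
  refine lt_of_le_of_lt (measure_mono fun x hx => ?_) (measure_biUnion_lt_top
    M.faces.finite_toSet fun F hF => hausdorffMeasure_convexHull_lt_top hn
      (M.mem_faces.1 hF).choose_spec.2.2)
  obtain ⟨K, hK, hxK⟩ := M.mem_surf_iff.1 (image_mono frontier_subset_closure hx)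
  have hKe : (⟨i, K⟩ : Elem n N) ∈ M.elems := M.mem_elems.2 hK
  obtain ⟨F, hFK, hxF⟩ := exists_mem_openSimplex hxK
  have hF : F ∈ M.complex.faces :=
    M.mem_faces_complex.2 ⟨nonempty_of_mem_openSimplex hxF, _, hKe, hFK⟩
  obtain ⟨S, hFS, hSK, hS⟩ := Finset.exists_subsuperset_card_eq hFK
    (M.card_le_of_mem_frontier hF hxF hx) (by simp [M.card_emb hKe])
  exact mem_iUnion₂.2 ⟨S, M.mem_faces.2 ⟨_, hKe, hSK, hS⟩,
    convexHull_mono (Finset.coe_subset.2 hFS) (openSimplex_subset_convexHull hxF)⟩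

/-- The points at which two affine functions agree form a convex set, and elements meet in the
convex hull of their common vertices. -/
lemma affineMap_eq_of_eq_on_vertices (hp : p ∈ M.elems) (hq : q ∈ M.elems) {f g : E n →ᵃ[ℝ] ℝ}
    (h : ∀ a ∈ p.2, ∀ b ∈ q.2, G.Φ p.1 a = G.Φ q.1 b → f a = g b)
    (hx : x ∈ convexHull ℝ (p.2 : Set (E n))) (hy : y ∈ convexHull ℝ (q.2 : Set (E n)))
    (hxy : G.Φ p.1 x = G.Φ q.1 y) : f x = g y := by
  let agree : Set (E d) := {X | ∃ a b, G.Φ p.1 a = X ∧ G.Φ q.1 b = X ∧ f a = g b}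
  have hconvex : Convex ℝ agree := by
    rintro _ ⟨a, b, rfl, hb, hab⟩ _ ⟨a', b', rfl, hb', hab'⟩ s t - - hst
    refine ⟨s • a + t • a', s • b + t • b', ?_, ?_, ?_⟩
    · exact Convex.combo_affine_apply (f := (G.Φ p.1).toAffineMap) hst
    · rw [← hb, ← hb']
      exact Convex.combo_affine_apply (f := (G.Φ q.1).toAffineMap) hst
    · rw [Convex.combo_affine_apply hst, Convex.combo_affine_apply hst, hab, hab']
  have hvertices : G.Φ p.1 '' p.2 ∩ G.Φ q.1 '' q.2 ⊆ agree := by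
    rintro _ ⟨⟨a, ha, rfl⟩, b, hb, hab⟩
    exact ⟨a, b, rfl, hab, h a ha b hb hab.symm⟩
  obtain ⟨a, b, ha, hb, hab⟩ := convexHull_min hvertices hconvex <|
    M.conforming _ _ _ (M.mem_elems.1 hp) _ (M.mem_elems.1 hq)
      ⟨mem_image_of_mem _ hx, y, hy, hxy.symm⟩
  rwa [← (G.Φ p.1).injective ha, ← (G.Φ q.1).injective (hb.trans hxy)]

lemma bary_apply (hK : K ∈ M.T i) (z : E d) (hy : y ∈ K) :
    M.bary i K z y = if G.Φ i y = z then 1 else 0 := by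
  let b : AffineBasis K ℝ (E n) := ⟨(↑), M.indep i K hK, by
    simpa using (affineSpan_eq_top_iff_card_eq_finrank_add_one (M.indep i K hK)).2
      (by simpa using M.card_eq i K hK)⟩
  obtain ⟨f, hf⟩ := exists_affineMap_apply_eq b fun a => if G.Φ i a = z then 1 else 0
  have h : ∃ f : E n →ᵃ[ℝ] ℝ, ∀ y ∈ K, f y = if G.Φ i y = z then 1 else 0 :=
    ⟨f, fun y hy => hf ⟨y, hy⟩⟩
  rw [bary, dif_pos h]
  exact h.choose_spec y hy

lemma hat_apply (hK : K ∈ M.T i) (z : E d) (hx : x ∈ convexHull ℝ (K : Set (E n))) :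
    M.hat z i x = M.bary i K z x := by
  have h : ∃ K ∈ M.T i, x ∈ convexHull ℝ (K : Set (E n)) := ⟨K, hK, hx⟩
  rw [hat, dif_pos h]
  refine M.affineMap_eq_of_eq_on_vertices (p := ⟨i, h.choose⟩) (q := ⟨i, K⟩)
    (M.mem_elems.2 h.choose_spec.1) (M.mem_elems.2 hK) ?_ h.choose_spec.2 hx rfl
  intro a ha b hb hab
  rw [M.bary_apply h.choose_spec.1 z ha, M.bary_apply hK z hb, hab]

/-- The value of `E_h v` at a vertex, which is zero on `∂G`. -/
def nodeVal (v : Fin N → E n → ℝ) (z : E d) : ℝ := if z ∈ M.nodes then M.nodalAvg v z else 0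

/-- The restriction of `E_h v` to an element. -/
def enrichPoly (v : Fin N → E n → ℝ) (i : Fin N) (K : Finset (E n)) : E n →ᵃ[ℝ] ℝ :=
  ∑ z ∈ M.nodes, M.nodalAvg v z • M.bary i K z

variable (v : Fin N → E n → ℝ)

lemma nodeVal_of_mem_boundary (hz : z ∈ G.boundary) : M.nodeVal v z = 0 :=
  if_neg (by simp [nodes, hz])

lemma nodeVal_of_notMem_boundary (hp : p ∈ M.patch z) (hz : z ∉ G.boundary) :
    M.nodeVal v z = M.nodalAvg v z := by
  obtain ⟨hpe, hzp⟩ := M.mem_patch.1 hp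
  exact if_pos (Finset.mem_filter.2 ⟨Finset.mem_biUnion.2 ⟨p, hpe, hzp⟩, hz⟩)

lemma enrich_apply (hK : K ∈ M.T i) (hx : x ∈ convexHull ℝ (K : Set (E n))) :
    M.enrich v i x = M.enrichPoly v i K x := by
  simp only [enrich, enrichPoly, affineMap_sum_apply, M.hat_apply hK _ hx]
  rfl

lemma enrichPoly_apply_vertex (hK : K ∈ M.T i) (hy : y ∈ K) :
    M.enrichPoly v i K y = M.nodeVal v (G.Φ i y) := by
  rw [enrichPoly, affineMap_sum_apply, nodeVal]
  simp [M.bary_apply hK _ hy]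

lemma agreesOn_enrich (hK : K ∈ M.T i) : AgreesOn (M.enrich v i) K (M.enrichPoly v i K) :=
  ae_restrict_of_forall_mem (K.finite_toSet.isClosed_convexHull ℝ).measurableSet
    fun _ => M.enrich_apply v hK

lemma elemPoly_enrich (hK : K ∈ M.T i) : elemPoly (M.enrich v i) K = M.enrichPoly v i K :=
  elemPoly_eq (M.nonempty_interior_convexHull hK) (M.agreesOn_enrich v hK)

lemma exists_lipschitzOnWith_nhds_enrich (i : Fin N) :
    ∃ C, ∀ x ∈ G.Ω i, ∃ U ∈ 𝓝 x, LipschitzOnWith C (M.enrich v i) U := by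
  refine exists_lipschitzOnWith_nhds_of_closed_cover (G.polytopal i).isOpen
    (A := fun K : M.T i => convexHull ℝ (K.1 : Set (E n)))
    (fun K => K.1.finite_toSet.isClosed_convexHull ℝ) (fun x hx => ?_) fun K => ?_
  · obtain ⟨K, hK, hxK⟩ := M.exists_mem_convexHull_of_mem_closure (subset_closure hx)
    exact mem_iUnion.2 ⟨⟨K, hK⟩, hxK⟩
  · obtain ⟨C, hC⟩ := (M.enrichPoly v i K).lipschitzWith_of_finiteDimensional
    refine ⟨C, fun x hx y hy => ?_⟩
    rw [M.enrich_apply v K.2 hx, M.enrich_apply v K.2 hy]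
    exact hC x y

lemma continuousOn_enrich (i : Fin N) : ContinuousOn (M.enrich v i) (closure (G.Ω i)) := by
  have hcov : ⋃ K : M.T i, convexHull ℝ (K.1 : Set (E n)) = closure (G.Ω i) := by
    rw [← M.cover i]
    exact iUnion_subtype (· ∈ M.T i) fun K => convexHull ℝ (K.1 : Set (E n))
  rw [← hcov]
  refine (locallyFinite_of_finite _).continuousOn_iUnion
    (fun K => K.1.finite_toSet.isClosed_convexHull ℝ) fun K => ?_
  exact (M.enrichPoly v i K).continuous_of_finiteDimensional.continuousOn.congr
    fun x hx => M.enrich_apply v K.2 hx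

lemma memLp_enrich (i : Fin N) : MemLp (M.enrich v i) 2 (volume.restrict (G.Ω i)) :=
  memLp_restrict_of_continuousOn_isCompact (G.polytopal i).isOpen.measurableSet subset_closure
    (G.polytopal i).isBounded.isCompact_closure (G.polytopal i).isBounded.measure_lt_top
    (M.continuousOn_enrich v i) 2

lemma memV_enrich : M.MemV (M.enrich v) := fun i =>
  ⟨M.memLp_enrich v i, fun _ hK => ⟨_, M.agreesOn_enrich v hK⟩⟩

lemma hasWeakGradient_enrich (i : Fin N) :
    HasWeakGradient (G.Ω i) (M.enrich v i) (∇ (M.enrich v i)) := by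
  obtain ⟨C, hC⟩ := M.exists_lipschitzOnWith_nhds_enrich v i
  refine hasWeakGradient_of_locallyLipschitzOn (G.polytopal i).isOpen fun x hx => ?_
  obtain ⟨U, hU, hlip⟩ := hC x hx
  exact ⟨C, U, mem_nhdsWithin_of_mem_nhds hU, hlip⟩

lemma memLp_gradient_enrich (i : Fin N) :
    MemLp (∇ (M.enrich v i)) 2 (volume.restrict (G.Ω i)) := by
  obtain ⟨C, hC⟩ := M.exists_lipschitzOnWith_nhds_enrich v i
  have : IsFiniteMeasure (volume.restrict (G.Ω i)) :=
    ⟨by rw [Measure.restrict_apply_univ]; exact (G.polytopal i).isBounded.measure_lt_top⟩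
  refine MemLp.of_bound (measurable_gradient _).aestronglyMeasurable C
    (ae_restrict_of_forall_mem (G.polytopal i).isOpen.measurableSet fun x hx => ?_)
  obtain ⟨U, hU, hlip⟩ := hC x hx
  exact norm_gradient_le_of_lipschitzOnWith hU hlip

lemma hasTrace_enrich (hn : n = 1 ∨ n = 2) (i : Fin N) :
    HasTrace (G.Ω i) (M.enrich v i) (M.enrich v i) := by
  have hc := M.continuousOn_enrich v i
  have hw := M.hasWeakGradient_enrich v i
  refine ⟨?_, fun _ => M.enrich v i, fun _ => ∇ (M.enrich v i), ∇ (M.enrich v i),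
    fun _ => ⟨hc, M.memLp_enrich v i, hw, M.memLp_gradient_enrich v i⟩, hw, by simp, by simp,
    by simp⟩
  exact memLp_restrict_of_continuousOn_isCompact isClosed_frontier.measurableSet
    frontier_subset_closure (G.polytopal i).isBounded.isCompact_closure
    (M.hausdorffMeasure_frontier_lt_top hn i) hc 2

lemma enrich_eq_of_apply_eq (hx : x ∈ closure (G.Ω i)) (hy : y ∈ closure (G.Ω j))
    (hxy : G.Φ i x = G.Φ j y) : M.enrich v i x = M.enrich v j y := by
  obtain ⟨K, hK, hxK⟩ := M.exists_mem_convexHull_of_mem_closure hx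
  obtain ⟨L, hL, hyL⟩ := M.exists_mem_convexHull_of_mem_closure hy
  rw [M.enrich_apply v hK hxK, M.enrich_apply v hL hyL]
  refine M.affineMap_eq_of_eq_on_vertices (p := ⟨i, K⟩) (q := ⟨j, L⟩) (M.mem_elems.2 hK)
    (M.mem_elems.2 hL) (fun a ha b hb hab => ?_) hxK hyL hxy
  rw [M.enrichPoly_apply_vertex v hK ha, M.enrichPoly_apply_vertex v hL hb, hab]

lemma enrich_eq_zero_of_mem_boundary (hy : y ∈ closure (G.Ω i))
    (hb : G.Φ i y ∈ G.boundary) : M.enrich v i y = 0 := by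
  obtain ⟨K, hK, hyK⟩ := M.exists_mem_convexHull_of_mem_closure hy
  obtain ⟨S, hSK, hyS⟩ := exists_mem_openSimplex hyK
  have hface : S.image (G.Φ i).toAffineMap ∈ M.complex.faces :=
    M.mem_faces_complex.2 ⟨(nonempty_of_mem_openSimplex hyS).image _, ⟨i, K⟩, M.mem_elems.2 hK,
      Finset.image_subset_image hSK⟩
  have hsub := M.convexHull_subset_boundary hface ⟨G.Φ i y, by
    rw [openSimplex_image (G.Φ i).injective]; exact mem_image_of_mem _ hyS, hb⟩
  have hzero : convexHull ℝ (S : Set (E n)) ⊆ M.enrichPoly v i K ⁻¹' {0} := by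
    refine convexHull_min (fun a ha => ?_) ((convex_singleton 0).affine_preimage _)
    exact (M.enrichPoly_apply_vertex v hK (hSK ha)).trans <| M.nodeVal_of_mem_boundary v <|
      hsub (subset_convexHull ℝ _ (Finset.mem_image_of_mem _ ha))
  exact (M.enrich_apply v hK hyK).trans (hzero (openSimplex_subset_convexHull hyS))

lemma memH10_enrich (hn : n = 1 ∨ n = 2) : G.MemH10 (M.enrich v) := by
  refine ⟨fun i => ⟨M.memLp_enrich v i, _, M.hasWeakGradient_enrich v i,
    M.memLp_gradient_enrich v i⟩, M.enrich v, M.hasTrace_enrich v hn, ?_, fun i => ?_⟩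
  · intro γ hγ i hi j hj
    refine ae_restrict_of_forall_mem (G.isClosed_of_mem_Γ hγ).measurableSet fun x hx => ?_
    obtain ⟨y, hy, rfl⟩ := G.mem_I.1 hi hx
    obtain ⟨y', hy', hyy'⟩ := G.mem_I.1 hj hx
    rw [G.coord_apply, ← hyy', G.coord_apply]
    exact M.enrich_eq_of_apply_eq v hy hy' hyy'.symm
  · have hclosed : IsClosed (G.Φ i '' frontier (G.Ω i)) :=
      (G.Φ i).isometry.isClosedEmbedding.isClosedMap _ isClosed_frontier
    refine ae_restrict_of_forall_mem (hclosed.inter isClosed_closure).measurableSet ?_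
    rintro _ ⟨⟨y, hy, rfl⟩, hyb⟩
    rw [G.coord_apply]
    exact M.enrich_eq_zero_of_mem_boundary v (frontier_subset_closure hy) hyb

lemma val_apply : M.val v i K (G.Φ i y) = elemPoly (v i) K y := by
  rw [val, coord_apply]

lemma val_enrich (hp : p ∈ M.patch z) : M.val (M.enrich v) p.1 p.2 z = M.nodeVal v z := by
  obtain ⟨hpe, hz⟩ := M.mem_patch.1 hp
  obtain ⟨y, hy, rfl⟩ := Finset.mem_image.1 hz
  rw [val_apply, M.elemPoly_enrich v (M.mem_elems.1 hpe),
    M.enrichPoly_apply_vertex v (M.mem_elems.1 hpe) hy]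

end Network.Mesh

/-! ### Inverse estimate on segments -/

section Segment

variable {V : Type*} [NormedAddCommGroup V] [NormedSpace ℝ V] [MeasurableSpace V] [BorelSpace V]

lemma measurableEmbedding_lineMap {x y : V} (hxy : x ≠ y) :
    MeasurableEmbedding (AffineMap.lineMap x y : ℝ → V) :=
  ((antilipschitzWith_lineMap hxy).isClosedEmbedding
    (lipschitzWith_lineMap x y).uniformContinuous).measurableEmbedding

lemma comap_lineMap_hausdorffMeasure {x y : V} (hxy : x ≠ y) :
    (μH[1] : Measure V).comap (AffineMap.lineMap x y : ℝ → V) = nndist x y • volume := by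
  ext s -
  rw [(measurableEmbedding_lineMap hxy).comap_apply, hausdorffMeasure_lineMap_image,
    hausdorffMeasure_real, Measure.smul_apply]

lemma setIntegral_segment {W : Type*} [NormedAddCommGroup W] [NormedSpace ℝ W] (x y : V)
    (f : V → W) :
    ∫ u in segment ℝ x y, f u ∂μH[1] =
      dist x y • ∫ t in (0 : ℝ)..1, f (AffineMap.lineMap x y t) := by
  rcases eq_or_ne x y with rfl | hxy
  · have hzero : μH[1] (segment ℝ x x) = 0 := by rw [hausdorffMeasure_segment, edist_self]
    rw [dist_self, zero_smul, setIntegral_measure_zero f hzero]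
  have he := measurableEmbedding_lineMap hxy
  rw [segment_eq_image_lineMap, ← inter_eq_left.2 (image_subset_range _ (Icc (0 : ℝ) 1)),
    ← Measure.restrict_restrict (he.measurableSet_image.2 measurableSet_Icc), ← he.map_comap,
    he.setIntegral_map, he.injective.preimage_image, comap_lineMap_hausdorffMeasure hxy,
    Measure.restrict_smul, integral_smul_nnreal_measure,
    intervalIntegral.integral_of_le zero_le_one, integral_Icc_eq_integral_Ioc, NNReal.smul_def,
    coe_nndist]

lemma dist_mul_sq_le_setIntegral_segment (x y : V) (f : V →ᵃ[ℝ] ℝ) :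
    dist x y * f x ^ 2 ≤ 4 * ∫ u in segment ℝ x y, f u ^ 2 ∂μH[1] := by
  have hint : ∫ t in (0 : ℝ)..1, f (AffineMap.lineMap x y t) ^ 2 =
      (f x ^ 2 + f x * f y + f y ^ 2) / 3 := by
    have hderiv : ∀ t ∈ uIcc (0 : ℝ) 1,
        HasDerivAt (fun t => f x ^ 2 * t + f x * (f y - f x) * t ^ 2 + (f y - f x) ^ 2 * t ^ 3 / 3)
          (f (AffineMap.lineMap x y t) ^ 2) t := fun t _ => by
      rw [AffineMap.apply_lineMap, AffineMap.lineMap_apply_ring']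
      exact ((((hasDerivAt_id t).const_mul (f x ^ 2)).add ((hasDerivAt_pow 2 t).const_mul
        (f x * (f y - f x)))).add (((hasDerivAt_pow 3 t).const_mul
          ((f y - f x) ^ 2)).div_const 3)).congr_deriv (by push_cast; ring)
    have hcont : Continuous fun t : ℝ => f (AffineMap.lineMap x y t) ^ 2 := by
      simp only [AffineMap.apply_lineMap, AffineMap.lineMap_apply_ring']
      fun_prop
    rw [intervalIntegral.integral_eq_sub_of_hasDerivAt hderiv (hcont.intervalIntegrable _ _)]
    ring
  rw [setIntegral_segment, hint, smul_eq_mul]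
  nlinarith [mul_nonneg (dist_nonneg (x := x) (y := y)) (sq_nonneg (f x + 2 * f y))]

end Segment

lemma dist_le_card_mul_of_reflTransGen {α X : Type*} [PseudoMetricSpace X] {s : Finset α}
    {r : α → α → Prop} {f : α → X} {B : ℝ} (hB : 0 ≤ B)
    (hr : ∀ a b, r a b → a ∈ s ∧ b ∈ s ∧ dist (f a) (f b) ≤ B) {a b : α} (ha : a ∈ s)
    (hab : Relation.ReflTransGen r a b) : dist (f a) (f b) ≤ s.card * B := by
  let H : SimpleGraph s := SimpleGraph.fromRel fun x y => r x y
  have hadj : ∀ x y : s, H.Adj x y → dist (f x) (f y) ≤ B := fun x y hxy =>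
    hxy.2.elim (fun h => (hr _ _ h).2.2) fun h => dist_comm (f x) (f y) ▸ (hr _ _ h).2.2
  have hwalk : ∀ {x y : s} (w : H.Walk x y), dist (f x) (f y) ≤ w.length * B := by
    intro x y w
    induction w with
    | nil => simp
    | @cons x y z hxy w ih =>
      rw [SimpleGraph.Walk.length_cons, Nat.cast_succ]
      linarith [dist_triangle (f x) (f y) (f z), hadj x y hxy]
  obtain ⟨hb, hreach⟩ : ∃ hb : b ∈ s, H.Reachable ⟨a, ha⟩ ⟨b, hb⟩ := by
    induction hab with
    | refl => exact ⟨ha, .refl _⟩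
    | @tail b c _ hbc ih =>
      obtain ⟨hb, hreach⟩ := ih
      refine ⟨(hr b c hbc).2.1, ?_⟩
      rcases eq_or_ne b c with rfl | hne
      · exact hreach
      · exact hreach.trans (SimpleGraph.Adj.reachable ⟨by simpa using hne, .inl hbc⟩)
  obtain ⟨w, hw⟩ := hreach.exists_isPath
  refine (hwalk w).trans ?_
  have hlen := hw.length_lt
  rw [Fintype.card_coe] at hlen
  gcongr

/-! ### Cardinality of patches -/

section Packing

variable {V : Type*} [NormedAddCommGroup V] [NormedSpace ℝ V]

lemma exists_closedBall_subset_inter_of_convex {K : Set V} (hK : Convex ℝ K) {y c : V} {s D t : ℝ}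
    (hy : y ∈ K) (hc : Metric.closedBall c s ⊆ K) (hD : K ⊆ Metric.closedBall y D) (ht₀ : 0 < t)
    (ht₁ : t ≤ 1) : ∃ c', Metric.closedBall c' (t * s) ⊆ K ∩ Metric.closedBall y (t * D) := by
  refine ⟨AffineMap.homothety y t c, fun x hx => ?_⟩
  obtain ⟨x, rfl⟩ : ∃ x', AffineMap.homothety y t x' = x :=
    ⟨AffineMap.homothety y t⁻¹ x, by
      rw [← AffineMap.homothety_mul_apply, mul_inv_cancel₀ ht₀.ne', AffineMap.homothety_one,
        AffineMap.id_apply]⟩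
  have hxK : x ∈ K := by
    refine hc (le_of_mul_le_mul_left ?_ ht₀)
    calc t * dist x c = dist (AffineMap.homothety y t x) (AffineMap.homothety y t c) := by
          simp only [AffineMap.homothety_apply, vsub_eq_sub, vadd_eq_add, dist_add_right,
            dist_smul₀, dist_sub_right, Real.norm_of_nonneg ht₀.le]
      _ ≤ t * s := hx
  refine ⟨?_, ?_⟩
  · rw [AffineMap.homothety_eq_lineMap]
    exact hK.lineMap_mem hy hxK ⟨ht₀.le, ht₁⟩
  · rw [Metric.mem_closedBall, dist_homothety_center, Real.norm_of_nonneg ht₀.le, dist_comm]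
    exact mul_le_mul_of_nonneg_left (hD hxK) ht₀.le

lemma card_le_pow_finrank_of_closedBall_subset [FiniteDimensional ℝ V] [MeasurableSpace V]
    [BorelSpace V] (μ : Measure V) [μ.IsAddHaarMeasure] {ι : Type*} {s : Finset ι} {A : ι → Set V}
    (hA : (s : Set ι).Pairwise (Function.onFun (AEDisjoint μ) A)) {y : V} {r ρ : ℝ} (hr : 0 < r)
    (hρ : 0 < ρ)
    (h : ∀ i ∈ s, ∃ c, Metric.closedBall c (r / ρ) ⊆ A i ∩ Metric.closedBall y r) :
    (s.card : ℝ) ≤ ρ ^ Module.finrank ℝ V := by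
  choose! c hc using h
  have hdisj : (s : Set ι).Pairwise
      (Function.onFun (AEDisjoint μ) fun i => Metric.closedBall (c i) (r / ρ)) :=
    fun i hi j hj hij => (hA hi hj hij).mono (subset_inter_iff.1 (hc i hi)).1
      (subset_inter_iff.1 (hc j hj)).1
  have hle : ∑ i ∈ s, μ (Metric.closedBall (c i) (r / ρ)) ≤ μ (Metric.closedBall y r) := by
    rw [← measure_biUnion_finset₀ hdisj fun _ _ =>
      Metric.isClosed_closedBall.measurableSet.nullMeasurableSet]
    exact measure_mono (iUnion₂_subset fun i hi => (subset_inter_iff.1 (hc i hi)).2)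
  simp_rw [Measure.addHaar_closedBall μ _ (div_pos hr hρ).le, Measure.addHaar_closedBall μ _ hr.le,
    Finset.sum_const, nsmul_eq_mul, ← mul_assoc] at hle
  rw [ENNReal.mul_le_mul_iff_left (Metric.measure_ball_pos _ _ one_pos).ne' measure_ball_lt_top.ne,
    ← ENNReal.ofReal_natCast, ← ENNReal.ofReal_mul (Nat.cast_nonneg _),
    ENNReal.ofReal_le_ofReal_iff (by positivity), div_pow, mul_div_assoc',
    div_le_iff₀ (by positivity), mul_comm (r ^ _)] at hle
  exact le_of_mul_le_mul_right hle (by positivity)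

end Packing

/-! ### Sizes -/

section Size

variable {k : ℕ} {K : Finset (E k)}

lemma size_nonneg (K : Finset (E k)) : 0 ≤ size K := Metric.diam_nonneg

lemma size_pair (a b : E k) : size {a, b} = dist a b := by
  rw [size, convexHull_diam, Finset.coe_pair, Metric.diam_pair]

lemma dist_le_size {x y : E k} (hx : x ∈ convexHull ℝ (K : Set (E k)))
    (hy : y ∈ convexHull ℝ (K : Set (E k))) : dist x y ≤ size K :=
  Metric.dist_le_diam_of_mem (K.finite_toSet.isCompact_convexHull (𝕜 := ℝ)).isBounded hx hy

lemma size_pos (hK : 1 < K.card) : 0 < size K := by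
  obtain ⟨a, ha, b, hb, hab⟩ := Finset.one_lt_card.1 hK
  exact (dist_pos.2 hab).trans_le
    (dist_le_size (subset_convexHull ℝ _ ha) (subset_convexHull ℝ _ hb))

end Size

namespace Network.Mesh

variable {n d N : ℕ} {G : Network n d N} (M : G.Mesh) {i : Fin N} {K L : Finset (E n)}
  {p q : Elem n N} {F : Finset (E d)} {z : E d} {ρ : ℝ}

lemma size_elem_pos (hn : 0 < n) (hK : K ∈ M.T i) : 0 < size K :=
  size_pos (by rw [M.card_eq i K hK]; exact Nat.lt_add_of_pos_left hn)

lemma size_le_h (hp : p ∈ M.elems) : size p.2 ≤ M.h :=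
  le_ciSup (f := fun p : M.elems => size p.1.2) (Set.finite_range _).bddAbove ⟨p, hp⟩

lemma aedisjoint_convexHull (hK : K ∈ M.T i) (hL : L ∈ M.T i) (hKL : K ≠ L) :
    AEDisjoint volume (convexHull ℝ (K : Set (E n))) (convexHull ℝ (L : Set (E n))) := by
  have hcard : (K ∩ L).card ≠ Module.finrank ℝ (E n) + 1 := by
    rw [finrank_euclideanSpace_fin]
    exact fun h => hKL <|
      (Finset.eq_of_subset_of_card_le Finset.inter_subset_left
        (by rw [h, M.card_eq i K hK])).symm.trans
        (Finset.eq_of_subset_of_card_le Finset.inter_subset_right (by rw [h, M.card_eq i L hL]))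
  refine measure_mono_null (M.convexHull_inter_subset hK hL) ?_
  rw [← Finset.coe_inter]
  exact addHaar_convexHull_eq_zero volume
    ((M.indep i K hK).mono (Finset.coe_subset.2 Finset.inter_subset_left)) hcard

lemma card_filter_mem_le (hn : 0 < n) (hρ : 0 < ρ) (hM : M.ShapeRegular ρ) (i : Fin N) (y : E n) :
    (((M.T i).filter (y ∈ ·)).card : ℝ) ≤ ρ ^ n := by
  rcases ((M.T i).filter (y ∈ ·)).eq_empty_or_nonempty with hempty | hne
  · rw [hempty, Finset.card_empty, Nat.cast_zero]
    positivity
  obtain ⟨K₀, hK₀, hmin⟩ := Finset.exists_min_image _ size hne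
  have hr : 0 < size K₀ := M.size_elem_pos hn (Finset.mem_filter.1 hK₀).1
  suffices h : (((M.T i).filter (y ∈ ·)).card : ℝ) ≤ ρ ^ Module.finrank ℝ (E n) by
    rwa [finrank_euclideanSpace_fin] at h
  refine card_le_pow_finrank_of_closedBall_subset volume (y := y) (r := size K₀)
    (A := fun K : Finset (E n) => convexHull ℝ (K : Set (E n)))
    (fun K hK L hL => M.aedisjoint_convexHull (Finset.mem_filter.1 hK).1 (Finset.mem_filter.1 hL).1)
    hr hρ fun K hK => ?_
  obtain ⟨hKT, hyK⟩ := Finset.mem_filter.1 hK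
  have hs := M.size_elem_pos hn hKT
  have hy : y ∈ convexHull ℝ (K : Set (E n)) := subset_convexHull ℝ _ hyK
  obtain ⟨c, hc⟩ := hM.1 ⟨i, K⟩ (M.mem_elems.2 hKT)
  obtain ⟨c', hc'⟩ := exists_closedBall_subset_inter_of_convex (convex_convexHull ℝ _) hy hc
    (fun x hx => dist_le_size hx hy) (div_pos hr hs) ((div_le_one hs).2 (hmin K hK))
  refine ⟨c', ?_⟩
  rwa [mul_div_assoc', div_mul_cancel₀ _ hs.ne'] at hc'

lemma card_patch_le (hn : 0 < n) (hρ : 0 < ρ) (hM : M.ShapeRegular ρ) (z : E d) :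
    ((M.patch z).card : ℝ) ≤ N * ρ ^ n := by
  have hsub : M.patch z ⊆ Finset.univ.sigma fun i => (M.T i).filter (G.coord i z ∈ ·) := by
    intro p hp
    obtain ⟨hpe, hpz⟩ := M.mem_patch.1 hp
    obtain ⟨y, hy, rfl⟩ := Finset.mem_image.1 hpz
    rw [Finset.mem_sigma, Finset.mem_filter, G.coord_apply]
    exact ⟨Finset.mem_univ _, M.mem_elems.1 hpe, hy⟩
  calc ((M.patch z).card : ℝ) ≤ ∑ i, (((M.T i).filter (G.coord i z ∈ ·)).card : ℝ) := by
        exact_mod_cast (Finset.card_le_card hsub).trans (Finset.card_sigma _ _).le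
    _ ≤ ∑ _ : Fin N, ρ ^ n :=
        Finset.sum_le_sum fun i _ => M.card_filter_mem_le hn hρ hM i (G.coord i z)
    _ = N * ρ ^ n := by rw [Finset.sum_const, Finset.card_fin, nsmul_eq_mul]

end Network.Mesh

/-! ### Norms on faces -/

namespace Network.Mesh

variable {n d N : ℕ} {G : Network n d N} (M : G.Mesh) {v : Fin N → E n → ℝ} {p q : Elem n N}
  {F : Finset (E d)} {z : E d} {ρ : ℝ}

lemma size_le_hF (hn : n = 1) (hp : p ∈ M.elems) (hF : F ⊆ M.emb p) : size p.2 ≤ M.hF F := by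
  rw [Network.Mesh.hF, if_pos hn]
  exact le_ciSup (f := fun p : M.elems.filter (F ⊆ M.emb ·) => size p.1.2)
    (Set.finite_range _).bddAbove ⟨p, Finset.mem_filter.2 ⟨hp, hF⟩⟩

lemma hF_pair (hn : n ≠ 1) (a b : E d) : M.hF {a, b} = dist a b := by
  rw [hF, if_neg hn, size_pair]

lemma hF_pos (hn : 0 < n) (hF : F ∈ M.faces) : 0 < M.hF F := by
  obtain ⟨p, hp, hFp, hcard⟩ := M.mem_faces.1 hF
  by_cases h1 : n = 1
  · exact (M.size_elem_pos hn (M.mem_elems.1 hp)).trans_le (M.size_le_hF h1 hp hFp)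
  · rw [Network.Mesh.hF, if_neg h1]
    exact size_pos (by omega)

lemma hF_le_mul_size (hn : n = 1) (hM : M.ShapeRegular ρ) (hp : p ∈ M.patch z) (hF : F ∈ M.faces)
    (hz : z ∈ F) : M.hF F ≤ ρ * size p.2 := by
  obtain ⟨q, hq, hFq, -⟩ := M.mem_faces.1 hF
  obtain ⟨hpe, hzp⟩ := M.mem_patch.1 hp
  rw [Network.Mesh.hF, if_pos hn]
  have : Nonempty (M.elems.filter (F ⊆ M.emb ·)) := ⟨⟨q, Finset.mem_filter.2 ⟨hq, hFq⟩⟩⟩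
  refine ciSup_le fun r => ?_
  obtain ⟨hr, hFr⟩ := Finset.mem_filter.1 r.2
  exact hM.2 hn _ hr _ hpe ⟨z, Finset.mem_inter.2 ⟨hFr hz, hzp⟩⟩

lemma size_zpow_le (hn : n = 1 ∨ n = 2) (hM : M.ShapeRegular ρ) (hp : p ∈ M.patch z)
    (hF : F ∈ M.faces) (hz : z ∈ F) :
    size p.2 ^ ((n : ℤ) - 2) ≤ max 1 ρ * M.hF F ^ ((n : ℤ) - 2) := by
  have hn₀ : 0 < n := by omega
  have hs := M.size_elem_pos hn₀ (M.mem_elems.1 (M.mem_patch.1 hp).1)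
  have hh := M.hF_pos hn₀ hF
  rcases hn with hn | rfl
  · have hweight : ∀ x : ℝ, x ^ ((n : ℤ) - 2) = x⁻¹ := by simp [hn]
    rw [hweight, hweight, ← div_eq_mul_inv, le_div_iff₀ hh, inv_mul_le_iff₀ hs, mul_comm]
    exact (M.hF_le_mul_size hn hM hp hF hz).trans (by gcongr; exact le_max_right _ _)
  · simp

lemma faceSq_nonneg (F : Finset (E d)) (f : E d → ℝ) : 0 ≤ M.faceSq F f :=
  integral_nonneg fun _ => sq_nonneg _

lemma faceSq_sub_comm (F : Finset (E d)) (f g : E d → ℝ) :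
    M.faceSq F (fun x => f x - g x) = M.faceSq F fun x => g x - f x := by
  simp only [faceSq, fun x => sub_sq_comm (f x) (g x)]

lemma faceSq_congr {f g : E d → ℝ} (h : EqOn f g (convexHull ℝ (F : Set (E d)))) :
    M.faceSq F f = M.faceSq F g :=
  setIntegral_congr_fun (F.finite_toSet.isClosed_convexHull (𝕜 := ℝ)).measurableSet
    fun x hx => by simp only [h hx]

lemma faceSq_singleton (hn : n = 1) (z : E d) (f : E d → ℝ) : M.faceSq {z} f = f z ^ 2 := by
  simp [faceSq, hn]

lemma faceSq_pair (hn : n = 2) (a b : E d) (f : E d → ℝ) :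
    M.faceSq {a, b} f = ∫ x in segment ℝ a b, f x ^ 2 ∂μH[1] := by
  rw [faceSq, Finset.coe_pair, convexHull_pair, hn, Nat.cast_ofNat,
    show (2 : ℝ) - 1 = 1 by norm_num]

lemma hF_zpow_mul_sq_le (hn : n = 1 ∨ n = 2) (hF : F ∈ M.faces) (hz : z ∈ F) {f : E d → ℝ}
    {g : E d →ᵃ[ℝ] ℝ} (hfg : EqOn f g (convexHull ℝ (F : Set (E d)))) :
    M.hF F ^ ((n : ℤ) - 2) * f z ^ 2 ≤ 4 * (M.faceSq F f / M.hF F) := by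
  have hh : 0 < M.hF F := M.hF_pos (by omega) hF
  obtain ⟨-, -, -, hcard⟩ := M.mem_faces.1 hF
  rcases hn with rfl | rfl
  · obtain ⟨a, rfl⟩ := Finset.card_eq_one.1 hcard
    obtain rfl := Finset.mem_singleton.1 hz
    rw [M.faceSq_singleton rfl, show ((1 : ℕ) : ℤ) - 2 = -1 by norm_num, zpow_neg_one,
      inv_mul_eq_div]
    exact le_mul_of_one_le_left (by positivity) (by norm_num)
  · obtain ⟨a, rfl⟩ : ∃ a, F = {z, a} := by
      obtain ⟨x, y, -, rfl⟩ := Finset.card_eq_two.1 hcard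
      rcases Finset.mem_insert.1 hz with rfl | hz
      · exact ⟨y, rfl⟩
      · exact ⟨x, by rw [Finset.mem_singleton.1 hz, Finset.pair_comm]⟩
    rw [show ((2 : ℕ) : ℤ) - 2 = 0 by norm_num, zpow_zero, one_mul, mul_div_assoc',
      le_div_iff₀ hh, M.hF_pair (by norm_num), M.faceSq_congr hfg, M.faceSq_pair rfl,
      hfg (subset_convexHull ℝ _ hz), mul_comm]
    exact dist_mul_sq_le_setIntegral_segment z a g

lemma exists_affineMap_eqOn_val (v : Fin N → E n → ℝ) (hF : F ⊆ M.emb p) :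
    ∃ g : E d →ᵃ[ℝ] ℝ, EqOn (M.val v p.1 p.2) g (convexHull ℝ (F : Set (E d))) := by
  obtain ⟨L, hL⟩ := LinearMap.exists_leftInverse_of_injective (G.Φ p.1).linear
    (LinearMap.ker_eq_bot.2 ((G.Φ p.1).toAffineMap.linear_injective_iff.2 (G.Φ p.1).injective))
  have hleft : ∀ y, L (G.Φ p.1 y) - L (G.Φ p.1 0) = y := fun y => by
    have hlin : (G.Φ p.1).linear (y - 0) = G.Φ p.1 y - G.Φ p.1 0 :=
      (G.Φ p.1).toAffineMap.linearMap_vsub y 0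
    rw [← map_sub, ← hlin, sub_zero, ← LinearMap.comp_apply, hL, LinearMap.id_apply]
  refine ⟨(elemPoly (v p.1) p.2).comp
    (L.toAffineMap - AffineMap.const ℝ (E d) (L (G.Φ p.1 0))), fun x hx => ?_⟩
  obtain ⟨y, -, rfl⟩ := M.convexHull_emb p ▸ convexHull_mono (Finset.coe_subset.2 hF) hx
  rw [val_apply]
  exact congrArg _ (hleft y).symm

end Network.Mesh

/-! ### Penalties -/

lemma single_le_sum_sum_sum {ι κ : Type*} {s : Finset (ι × ι)} {t : ι → Finset κ}
    {J : ι × ι → κ → κ → ℝ} (hJ : ∀ p K L, 0 ≤ J p K L) {i j : ι} {K L : κ} (hij : (i, j) ∈ s)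
    (hK : K ∈ t i) (hL : L ∈ t j) :
    J (i, j) K L ≤ ∑ p ∈ s, ∑ K ∈ t p.1, ∑ L ∈ t p.2, J p K L :=
  calc J (i, j) K L ≤ ∑ L ∈ t j, J (i, j) K L :=
        Finset.single_le_sum (fun L _ => hJ (i, j) K L) hL
    _ ≤ ∑ K ∈ t i, ∑ L ∈ t j, J (i, j) K L :=
        Finset.single_le_sum (f := fun K => ∑ L ∈ t j, J (i, j) K L)
          (fun K _ => Finset.sum_nonneg fun L _ => hJ (i, j) K L) hK
    _ ≤ _ := Finset.single_le_sum
          (f := fun p : ι × ι => ∑ K ∈ t p.1, ∑ L ∈ t p.2, J p K L)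
          (fun p _ => Finset.sum_nonneg fun K _ => Finset.sum_nonneg fun L _ => hJ p K L) hij

namespace Network.Mesh

variable {n d N : ℕ} {G : Network n d N} (M : G.Mesh)

/-- The penalty term of the DG norm for a face `F` inside domain `i`. -/
def intPenalty (ηF : Fin N → Finset (E d) → ℝ) (v : Fin N → E n → ℝ) (i : Fin N)
    (F : Finset (E d)) : ℝ :=
  ηF i F / M.hF F * (1 / 2 * ∑ q ∈ (M.elemsAt i F).offDiag,
    M.faceSq F fun x => M.val v i q.1 x - M.val v i q.2 x)

/-- The penalty term of the DG norm for a face `F` of domain `i` on `∂G`. -/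
def bdPenalty (ηF : Fin N → Finset (E d) → ℝ) (v : Fin N → E n → ℝ) (i : Fin N)
    (F : Finset (E d)) : ℝ :=
  ηF i F / M.hF F * ∑ K ∈ M.elemsAt i F, M.faceSq F fun x => M.val v i K x

/-- The penalty term of the DG norm for a face `F` on the bifurcation `γ`. -/
def bifPenalty (ηΓ : Set (E d) → ℝ) (v : Fin N → E n → ℝ) (γ : Set (E d))
    (F : Finset (E d)) : ℝ :=
  ηΓ γ * (1 / M.hF F * ∑ p ∈ G.D γ, ∑ K ∈ M.elemsAt p.1 F, ∑ L ∈ M.elemsAt p.2 F,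
    M.faceSq F fun x => M.val v p.1 K x - M.val v p.2 L x)

/-- All penalty terms of the DG norm for the face `F`. -/
def facePenalty (ηF : Fin N → Finset (E d) → ℝ) (ηΓ : Set (E d) → ℝ) (v : Fin N → E n → ℝ)
    (F : Finset (E d)) : ℝ :=
  ∑ i with F ∈ M.intFaces i, M.intPenalty ηF v i F +
    ∑ i with F ∈ M.bdFaces i, M.bdPenalty ηF v i F +
    ∑ γ ∈ G.Γ with F ∈ M.bifFaces γ, M.bifPenalty ηΓ v γ F

/-- All penalty terms of the DG norm for the faces with the vertex `z`. -/
def localPenalty (ηF : Fin N → Finset (E d) → ℝ) (ηΓ : Set (E d) → ℝ) (v : Fin N → E n → ℝ)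
    (z : E d) : ℝ :=
  ∑ F ∈ M.faces with z ∈ F, M.facePenalty ηF ηΓ v F

variable {ηF : Fin N → Finset (E d) → ℝ} {ηΓ : Set (E d) → ℝ} (v : Fin N → E n → ℝ) {i j : Fin N}
  {γ : Set (E d)} {F : Finset (E d)} {K L : Finset (E n)} {p q r : Elem n N} {z : E d} {ρ η₀ : ℝ}

lemma hF_nonneg (F : Finset (E d)) : 0 ≤ M.hF F := by
  rw [hF]
  split_ifs
  · exact Real.iSup_nonneg fun _ => size_nonneg _
  · exact size_nonneg _

lemma intPenalty_nonneg (hηF : 0 ≤ ηF i F) : 0 ≤ M.intPenalty ηF v i F :=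
  mul_nonneg (div_nonneg hηF (M.hF_nonneg F)) <|
    mul_nonneg (by norm_num) (Finset.sum_nonneg fun _ _ => M.faceSq_nonneg F _)

lemma bdPenalty_nonneg (hηF : 0 ≤ ηF i F) : 0 ≤ M.bdPenalty ηF v i F :=
  mul_nonneg (div_nonneg hηF (M.hF_nonneg F)) (Finset.sum_nonneg fun _ _ => M.faceSq_nonneg F _)

lemma bifPenalty_nonneg (hηΓ : 0 ≤ ηΓ γ) : 0 ≤ M.bifPenalty ηΓ v γ F :=
  mul_nonneg hηΓ <| mul_nonneg (one_div_nonneg.2 (M.hF_nonneg F)) <| Finset.sum_nonneg fun _ _ =>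
    Finset.sum_nonneg fun _ _ => Finset.sum_nonneg fun _ _ => M.faceSq_nonneg F _

section

variable (hηF : ∀ i F, 0 ≤ ηF i F) (hηΓ : ∀ γ, 0 ≤ ηΓ γ)
include hηF hηΓ

lemma facePenalty_nonneg (F : Finset (E d)) : 0 ≤ M.facePenalty ηF ηΓ v F :=
  add_nonneg (add_nonneg (Finset.sum_nonneg fun i _ => M.intPenalty_nonneg v (hηF i F))
    (Finset.sum_nonneg fun i _ => M.bdPenalty_nonneg v (hηF i F)))
    (Finset.sum_nonneg fun γ _ => M.bifPenalty_nonneg v (hηΓ γ))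

lemma localPenalty_nonneg (z : E d) : 0 ≤ M.localPenalty ηF ηΓ v z :=
  Finset.sum_nonneg fun F _ => M.facePenalty_nonneg v hηF hηΓ F

lemma facePenalty_le_localPenalty (hF : F ∈ M.faces) (hz : z ∈ F) :
    M.facePenalty ηF ηΓ v F ≤ M.localPenalty ηF ηΓ v z :=
  Finset.single_le_sum (f := M.facePenalty ηF ηΓ v)
    (fun F _ => M.facePenalty_nonneg v hηF hηΓ F) (Finset.mem_filter.2 ⟨hF, hz⟩)

lemma intPenalty_le_facePenalty (hF : F ∈ M.intFaces i) :
    M.intPenalty ηF v i F ≤ M.facePenalty ηF ηΓ v F := by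
  have hint := Finset.single_le_sum (f := fun i => M.intPenalty ηF v i F)
    (s := Finset.univ.filter fun i => F ∈ M.intFaces i)
    (fun i _ => M.intPenalty_nonneg v (hηF i F)) (Finset.mem_filter.2 ⟨Finset.mem_univ i, hF⟩)
  exact hint.trans <| (le_add_of_nonneg_right <|
    Finset.sum_nonneg fun i _ => M.bdPenalty_nonneg v (hηF i F)).trans <|
    le_add_of_nonneg_right <| Finset.sum_nonneg fun γ _ => M.bifPenalty_nonneg v (hηΓ γ)

lemma bdPenalty_le_facePenalty (hF : F ∈ M.bdFaces i) :
    M.bdPenalty ηF v i F ≤ M.facePenalty ηF ηΓ v F := by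
  have hbd := Finset.single_le_sum (f := fun i => M.bdPenalty ηF v i F)
    (s := Finset.univ.filter fun i => F ∈ M.bdFaces i)
    (fun i _ => M.bdPenalty_nonneg v (hηF i F)) (Finset.mem_filter.2 ⟨Finset.mem_univ i, hF⟩)
  exact hbd.trans <| (le_add_of_nonneg_left <|
    Finset.sum_nonneg fun i _ => M.intPenalty_nonneg v (hηF i F)).trans <|
    le_add_of_nonneg_right <| Finset.sum_nonneg fun γ _ => M.bifPenalty_nonneg v (hηΓ γ)

lemma bifPenalty_le_facePenalty (hγ : γ ∈ G.Γ) (hF : F ∈ M.bifFaces γ) :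
    M.bifPenalty ηΓ v γ F ≤ M.facePenalty ηF ηΓ v F := by
  have hbif := Finset.single_le_sum (f := fun γ => M.bifPenalty ηΓ v γ F)
    (s := G.Γ.filter fun γ => F ∈ M.bifFaces γ)
    (fun γ _ => M.bifPenalty_nonneg v (hηΓ γ)) (Finset.mem_filter.2 ⟨hγ, hF⟩)
  exact hbif.trans <| le_add_of_nonneg_left <|
    add_nonneg (Finset.sum_nonneg fun i _ => M.intPenalty_nonneg v (hηF i F))
      (Finset.sum_nonneg fun i _ => M.bdPenalty_nonneg v (hηF i F))

lemma sum_localPenalty_le (s : Finset (E d)) :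
    ∑ z ∈ s, M.localPenalty ηF ηΓ v z ≤ n * ∑ F ∈ M.faces, M.facePenalty ηF ηΓ v F := by
  calc ∑ z ∈ s, M.localPenalty ηF ηΓ v z
      = ∑ F ∈ M.faces, ∑ _z ∈ s with _z ∈ F, M.facePenalty ηF ηΓ v F :=
        Finset.sum_comm' fun z F => by simp only [Finset.mem_filter]; tauto
    _ ≤ ∑ F ∈ M.faces, n * M.facePenalty ηF ηΓ v F := by
        refine Finset.sum_le_sum fun F hF => ?_
        obtain ⟨-, -, -, hcard⟩ := M.mem_faces.1 hF
        rw [Finset.sum_const, nsmul_eq_mul]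
        refine mul_le_mul_of_nonneg_right (Nat.cast_le.2 ?_) (M.facePenalty_nonneg v hηF hηΓ F)
        exact hcard ▸ Finset.card_le_card fun z hz => (Finset.mem_filter.1 hz).2
    _ = _ := (Finset.mul_sum _ _ _).symm

lemma sq_dgNorm : M.dgNorm ηF ηΓ v ^ 2 =
    ∑ i, ∑ K ∈ M.T i,
        (∫ x in convexHull ℝ (K : Set (E n)), ‖∇ (elemPoly (v i) K : E n → ℝ) x‖ ^ 2) +
      ∑ F ∈ M.faces, M.facePenalty ηF ηΓ v F := by
  have hint : ∑ F ∈ M.faces, ∑ i with F ∈ M.intFaces i, M.intPenalty ηF v i F =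
      ∑ i, ∑ F ∈ M.intFaces i, M.intPenalty ηF v i F :=
    Finset.sum_comm' fun F i => by simp [intFaces]
  have hbd : ∑ F ∈ M.faces, ∑ i with F ∈ M.bdFaces i, M.bdPenalty ηF v i F =
      ∑ i, ∑ F ∈ M.bdFaces i, M.bdPenalty ηF v i F :=
    Finset.sum_comm' fun F i => by simp [bdFaces]
  have hbif : ∑ F ∈ M.faces, ∑ γ ∈ G.Γ with F ∈ M.bifFaces γ, M.bifPenalty ηΓ v γ F =
      ∑ γ ∈ G.Γ, ∑ F ∈ M.bifFaces γ, M.bifPenalty ηΓ v γ F :=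
    Finset.sum_comm' fun F γ => by simp only [bifFaces, Finset.mem_filter]; tauto
  have hnonneg := add_nonneg
    (Finset.sum_nonneg fun i (_ : i ∈ Finset.univ) => Finset.sum_nonneg fun K (_ : K ∈ M.T i) =>
      integral_nonneg (μ := volume.restrict (convexHull ℝ (K : Set (E n))))
        fun x => sq_nonneg ‖∇ (elemPoly (v i) K : E n → ℝ) x‖)
    (Finset.sum_nonneg fun F (_ : F ∈ M.faces) => M.facePenalty_nonneg v hηF hηΓ F)
  rw [dgNorm, ← Real.sq_sqrt hnonneg]
  congr 2
  simp only [facePenalty, Finset.sum_add_distrib, hint, hbd, hbif]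
  simp only [dgSqDom, intPenalty, bdPenalty, bifPenalty, Finset.sum_add_distrib, ← Finset.mul_sum,
    add_assoc]

end

/-! ### Control of the jumps at a vertex -/

section

variable (hη₀ : 0 ≤ η₀) (hηF : ∀ i F, η₀ ≤ ηF i F) (hηΓ : ∀ γ, η₀ ≤ ηΓ γ)

include hη₀ hηF in
lemma div_mul_faceSq_sub_le_intPenalty (hK : K ∈ M.elemsAt i F) (hL : L ∈ M.elemsAt i F)
    (hKL : K ≠ L) :
    η₀ / M.hF F * M.faceSq F (fun x => M.val v i K x - M.val v i L x) ≤
      2 * M.intPenalty ηF v i F := by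
  have hle := Finset.single_le_sum (s := (M.elemsAt i F).offDiag)
    (f := fun q => M.faceSq F fun x => M.val v i q.1 x - M.val v i q.2 x)
    (fun q _ => M.faceSq_nonneg F _) (Finset.mem_offDiag (x := (K, L)).2 ⟨hK, hL, hKL⟩)
  calc η₀ / M.hF F * M.faceSq F (fun x => M.val v i K x - M.val v i L x)
      ≤ ηF i F / M.hF F * _ := mul_le_mul (div_le_div_of_nonneg_right (hηF i F) (M.hF_nonneg F))
        hle (M.faceSq_nonneg F _) (div_nonneg (hη₀.trans (hηF i F)) (M.hF_nonneg F))
    _ = 2 * M.intPenalty ηF v i F := by rw [intPenalty]; ring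

include hη₀ hηΓ in
lemma div_mul_faceSq_sub_le_bifPenalty (hij : (i, j) ∈ G.D γ) (hK : K ∈ M.elemsAt i F)
    (hL : L ∈ M.elemsAt j F) :
    η₀ / M.hF F * M.faceSq F (fun x => M.val v i K x - M.val v j L x) ≤
      M.bifPenalty ηΓ v γ F := by
  have hle := single_le_sum_sum_sum (t := fun i => M.elemsAt i F)
    (J := fun p K L => M.faceSq F fun x => M.val v p.1 K x - M.val v p.2 L x)
    (fun _ _ _ => M.faceSq_nonneg F _) hij hK hL
  rw [bifPenalty, ← mul_assoc, mul_one_div]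
  exact mul_le_mul (div_le_div_of_nonneg_right (hηΓ γ) (M.hF_nonneg F)) hle (M.faceSq_nonneg F _)
    (div_nonneg (hη₀.trans (hηΓ γ)) (M.hF_nonneg F))

include hη₀ hηF in
lemma div_mul_faceSq_le_bdPenalty (hK : K ∈ M.elemsAt i F) :
    η₀ / M.hF F * M.faceSq F (M.val v i K) ≤ M.bdPenalty ηF v i F :=
  mul_le_mul (div_le_div_of_nonneg_right (hηF i F) (M.hF_nonneg F))
    (Finset.single_le_sum (f := fun K => M.faceSq F (M.val v i K))
      (fun _ _ => M.faceSq_nonneg F _) hK)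
    (M.faceSq_nonneg F _) (div_nonneg (hη₀.trans (hηF i F)) (M.hF_nonneg F))

include hη₀ hηF hηΓ

lemma div_mul_faceSq_sub_le_facePenalty (hF : F ∈ M.faces) (hp : p ∈ M.elems) (hq : q ∈ M.elems)
    (hFp : F ⊆ M.emb p) (hFq : F ⊆ M.emb q)
    (hpq : p.1 = q.1 ∨ ∃ γ ∈ G.Γ, convexHull ℝ (F : Set (E d)) ⊆ γ ∧ p.1 ∈ G.I γ ∧ q.1 ∈ G.I γ) :
    η₀ / M.hF F * M.faceSq F (fun x => M.val v p.1 p.2 x - M.val v q.1 q.2 x) ≤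
      2 * M.facePenalty ηF ηΓ v F := by
  have hηF₀ : ∀ i F, 0 ≤ ηF i F := fun i F => hη₀.trans (hηF i F)
  have hηΓ₀ : ∀ γ, 0 ≤ ηΓ γ := fun γ => hη₀.trans (hηΓ γ)
  have hnonneg := M.facePenalty_nonneg v hηF₀ hηΓ₀ F
  have hpF : p.2 ∈ M.elemsAt p.1 F := M.mem_elemsAt.2 ⟨M.mem_elems.1 hp, hFp⟩
  have hqF : q.2 ∈ M.elemsAt q.1 F := M.mem_elemsAt.2 ⟨M.mem_elems.1 hq, hFq⟩
  obtain ⟨i, K⟩ := p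
  obtain ⟨j, L⟩ := q
  rcases lt_trichotomy i j with hij | rfl | hij
  · obtain ⟨γ, hγ, hFγ, hi, hj⟩ := hpq.resolve_left hij.ne
    have hD : (i, j) ∈ G.D γ := by simp [Network.D, hij, hi, hj]
    linarith [M.div_mul_faceSq_sub_le_bifPenalty v hη₀ hηΓ hD hpF hqF,
      M.bifPenalty_le_facePenalty v hηF₀ hηΓ₀ hγ (Finset.mem_filter.2 ⟨hF, hFγ⟩)]
  · rcases eq_or_ne K L with rfl | hKL
    · simpa [faceSq] using hnonneg
    · have hint : F ∈ M.intFaces i :=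
        Finset.mem_filter.2 ⟨hF, Finset.one_lt_card.2 ⟨K, hpF, L, hqF, hKL⟩⟩
      linarith [M.div_mul_faceSq_sub_le_intPenalty v hη₀ hηF hpF hqF hKL,
        M.intPenalty_le_facePenalty v hηF₀ hηΓ₀ hint]
  · obtain ⟨γ, hγ, hFγ, hi, hj⟩ := hpq.resolve_left hij.ne'
    have hD : (j, i) ∈ G.D γ := by simp [Network.D, hij, hi, hj]
    rw [M.faceSq_sub_comm]
    linarith [M.div_mul_faceSq_sub_le_bifPenalty v hη₀ hηΓ hD hqF hpF,
      M.bifPenalty_le_facePenalty v hηF₀ hηΓ₀ hγ (Finset.mem_filter.2 ⟨hF, hFγ⟩)]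

end

end Network.Mesh

/-! ### The defect of the enriching map at the vertices -/

/-- The constant in the bound of the defects at all vertices by the penalty terms: `N ρⁿ` bounds
the number of elements at a vertex, `8 max(1, ρ) / η₀` comes from the inverse inequality on a face
and the comparison of `h_F` with the sizes of the elements, and a face has `n` vertices. -/
def stabilityConst (n N : ℕ) (ρ η₀ : ℝ) : ℝ := (N * ρ ^ n + 1) ^ 3 * (8 * max 1 ρ / η₀) * n

namespace Network.Mesh

variable {n d N : ℕ} {G : Network n d N} (M : G.Mesh) {ηF : Fin N → Finset (E d) → ℝ}
  {ηΓ : Set (E d) → ℝ} (v : Fin N → E n → ℝ) {F : Finset (E d)} {p q r : Elem n N} {z : E d}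
  {ρ η₀ : ℝ}

lemma dist_nodeVal_le (hn : n = 1 ∨ n = 2) {B : ℝ} (hB : 0 ≤ B)
    (hjump : ∀ p q, M.Linked z p q → dist (M.val v p.1 p.2 z) (M.val v q.1 q.2 z) ≤ B)
    (hbd : ∀ q ∈ M.elems, ∀ F ∈ M.bdFaces q.1, z ∈ F → F ⊆ M.emb q → |M.val v q.1 q.2 z| ≤ B)
    (hp : p ∈ M.patch z) :
    dist (M.nodeVal v z) (M.val v p.1 p.2 z) ≤ ((M.patch z).card + 1) * B := by
  have hchain : ∀ q ∈ M.patch z,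
      dist (M.val v q.1 q.2 z) (M.val v p.1 p.2 z) ≤ (M.patch z).card * B := fun q hq =>
    dist_le_card_mul_of_reflTransGen hB (r := M.Linked z)
      (f := fun p : Elem n N => M.val v p.1 p.2 z)
      (fun a b hab => ⟨hab.1, hab.2.1, hjump a b hab⟩) hq (M.reflTransGen_linked hn hq hp)
  by_cases hz : z ∈ G.boundary
  · obtain ⟨q, hq, F, hF, hzF, hFq⟩ := M.exists_mem_bdFaces hn hp hz
    have hval := hbd q (M.mem_patch.1 hq).1 F hF hzF hFq
    rw [M.nodeVal_of_mem_boundary v hz, add_one_mul]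
    rw [← sub_zero (M.val v q.1 q.2 z), ← Real.dist_eq, dist_comm] at hval
    linarith [dist_triangle 0 (M.val v q.1 q.2 z) (M.val v p.1 p.2 z), hchain q hq]
  · have hcard : ((M.patch z).card : ℝ) ≠ 0 :=
      Nat.cast_ne_zero.2 (Finset.card_ne_zero_of_mem hp)
    have hmean := (convex_closedBall (M.val v p.1 p.2 z) ((M.patch z).card * B)).sum_mem
      (t := M.patch z) (w := fun _ => ((M.patch z).card : ℝ)⁻¹) (fun _ _ => by positivity)
      (by rw [Finset.sum_const, nsmul_eq_mul, mul_inv_cancel₀ hcard]) hchain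
    rw [← Finset.smul_sum, smul_eq_mul, Metric.mem_closedBall] at hmean
    rw [M.nodeVal_of_notMem_boundary v hp hz, nodalAvg]
    linarith

variable (hn : n = 1 ∨ n = 2) (hM : M.ShapeRegular ρ) (hη₀ : 0 < η₀)
  (hηF : ∀ i F, η₀ ≤ ηF i F) (hηΓ : ∀ γ, η₀ ≤ ηΓ γ)
include hn hM hη₀ hηF hηΓ

lemma size_zpow_mul_sq_le (hr : r ∈ M.patch z) (hF : F ∈ M.faces) (hz : z ∈ F) {f : E d → ℝ}
    {g : E d →ᵃ[ℝ] ℝ} (hfg : EqOn f g (convexHull ℝ (F : Set (E d))))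
    (hf : η₀ / M.hF F * M.faceSq F f ≤ 2 * M.facePenalty ηF ηΓ v F) :
    size r.2 ^ ((n : ℤ) - 2) * f z ^ 2 ≤ 8 * max 1 ρ / η₀ * M.localPenalty ηF ηΓ v z := by
  have hlocal := M.facePenalty_le_localPenalty v (fun i F => hη₀.le.trans (hηF i F))
    (fun γ => hη₀.le.trans (hηΓ γ)) hF hz
  calc size r.2 ^ ((n : ℤ) - 2) * f z ^ 2
      ≤ max 1 ρ * M.hF F ^ ((n : ℤ) - 2) * f z ^ 2 := by
        gcongr
        exact M.size_zpow_le hn hM hr hF hz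
    _ ≤ max 1 ρ * (4 * (M.faceSq F f / M.hF F)) := by
        rw [mul_assoc]
        exact mul_le_mul_of_nonneg_left (M.hF_zpow_mul_sq_le hn hF hz hfg) (by positivity)
    _ = 4 * max 1 ρ / η₀ * (η₀ / M.hF F * M.faceSq F f) := by field_simp
    _ ≤ 4 * max 1 ρ / η₀ * (2 * M.localPenalty ηF ηΓ v z) :=
        mul_le_mul_of_nonneg_left (by linarith) (by positivity)
    _ = _ := by ring

lemma size_zpow_mul_sq_jump_le (hr : r ∈ M.patch z) (hpq : M.Linked z p q) :
    size r.2 ^ ((n : ℤ) - 2) * (M.val v p.1 p.2 z - M.val v q.1 q.2 z) ^ 2 ≤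
      8 * max 1 ρ / η₀ * M.localPenalty ηF ηΓ v z := by
  obtain ⟨hp, hq, F, hF, hz, hFp, hFq, hlink⟩ := hpq
  obtain ⟨f, hf⟩ := M.exists_affineMap_eqOn_val v hFp
  obtain ⟨g, hg⟩ := M.exists_affineMap_eqOn_val v hFq
  exact M.size_zpow_mul_sq_le v hn hM hη₀ hηF hηΓ hr hF hz (g := f - g)
    (f := fun x => M.val v p.1 p.2 x - M.val v q.1 q.2 x)
    (fun x hx => congrArg₂ _ (hf hx) (hg hx))
    (M.div_mul_faceSq_sub_le_facePenalty v hη₀.le hηF hηΓ hF (M.mem_patch.1 hp).1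
      (M.mem_patch.1 hq).1 hFp hFq hlink)

lemma size_zpow_mul_sq_val_le (hr : r ∈ M.patch z) (hq : q ∈ M.elems) (hF : F ∈ M.bdFaces q.1)
    (hz : z ∈ F) (hFq : F ⊆ M.emb q) :
    size r.2 ^ ((n : ℤ) - 2) * M.val v q.1 q.2 z ^ 2 ≤
      8 * max 1 ρ / η₀ * M.localPenalty ηF ηΓ v z := by
  have hηF₀ : ∀ i F, 0 ≤ ηF i F := fun i F => hη₀.le.trans (hηF i F)
  have hηΓ₀ : ∀ γ, 0 ≤ ηΓ γ := fun γ => hη₀.le.trans (hηΓ γ)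
  obtain ⟨f, hf⟩ := M.exists_affineMap_eqOn_val v hFq
  refine M.size_zpow_mul_sq_le v hn hM hη₀ hηF hηΓ hr (Finset.mem_filter.1 hF).1 hz hf ?_
  linarith [M.facePenalty_nonneg v hηF₀ hηΓ₀ F, M.bdPenalty_le_facePenalty v hηF₀ hηΓ₀ hF,
    M.div_mul_faceSq_le_bdPenalty v hη₀.le hηF (M.mem_elemsAt.2 ⟨M.mem_elems.1 hq, hFq⟩)]

lemma size_zpow_mul_sq_nodeVal_sub_le (hp : p ∈ M.patch z) :
    size p.2 ^ ((n : ℤ) - 2) * (M.nodeVal v z - M.val v p.1 p.2 z) ^ 2 ≤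
      ((M.patch z).card + 1) ^ 2 * (8 * max 1 ρ / η₀ * M.localPenalty ηF ηΓ v z) := by
  have hw : 0 < size p.2 ^ ((n : ℤ) - 2) :=
    zpow_pos (M.size_elem_pos (by omega) (M.mem_elems.1 (M.mem_patch.1 hp).1)) _
  have hlocal := M.localPenalty_nonneg v (fun i F => hη₀.le.trans (hηF i F))
    (fun γ => hη₀.le.trans (hηΓ γ)) z
  have hdist := M.dist_nodeVal_le v hn (Real.sqrt_nonneg _)
    (fun a b hab => Real.le_sqrt_of_sq_le <| (le_div_iff₀' hw).2 <| by
      rw [Real.dist_eq, sq_abs]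
      exact M.size_zpow_mul_sq_jump_le v hn hM hη₀ hηF hηΓ hp hab)
    (fun q hq F hF hz hFq => Real.abs_le_sqrt <| (le_div_iff₀' hw).2 <|
      M.size_zpow_mul_sq_val_le v hn hM hη₀ hηF hηΓ hp hq hF hz hFq) hp
  rw [← le_div_iff₀' hw, ← sq_abs, ← Real.dist_eq, mul_div_assoc]
  refine (pow_le_pow_left₀ dist_nonneg hdist 2).trans_eq ?_
  rw [mul_pow, Real.sq_sqrt (by positivity)]

lemma sum_sq_nodeVal_sub_le (hρ : 0 < ρ) :
    ∑ p ∈ M.elems, ∑ z ∈ M.emb p,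
        size p.2 ^ ((n : ℤ) - 2) * (M.nodeVal v z - M.val v p.1 p.2 z) ^ 2 ≤
      stabilityConst n N ρ η₀ * ∑ F ∈ M.faces, M.facePenalty ηF ηΓ v F := by
  have hηF₀ : ∀ i F, 0 ≤ ηF i F := fun i F => hη₀.le.trans (hηF i F)
  have hηΓ₀ : ∀ γ, 0 ≤ ηΓ γ := fun γ => hη₀.le.trans (hηΓ γ)
  have hpatch : ∀ z, ∑ p ∈ M.patch z,
      size p.2 ^ ((n : ℤ) - 2) * (M.nodeVal v z - M.val v p.1 p.2 z) ^ 2 ≤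
        (N * ρ ^ n + 1) ^ 3 * (8 * max 1 ρ / η₀) * M.localPenalty ηF ηΓ v z := fun z => by
    have hcard := M.card_patch_le (by omega) hρ hM z
    have hlocal := M.localPenalty_nonneg v hηF₀ hηΓ₀ z
    refine (Finset.sum_le_card_nsmul _ _ _ fun p hp =>
      M.size_zpow_mul_sq_nodeVal_sub_le v hn hM hη₀ hηF hηΓ hp).trans ?_
    rw [nsmul_eq_mul, ← mul_assoc, mul_assoc _ (8 * max 1 ρ / η₀), pow_succ' _ 2]
    gcongr
    linarith
  calc ∑ p ∈ M.elems, ∑ z ∈ M.emb p,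
        size p.2 ^ ((n : ℤ) - 2) * (M.nodeVal v z - M.val v p.1 p.2 z) ^ 2
      = ∑ z ∈ M.elems.biUnion M.emb, ∑ p ∈ M.patch z,
          size p.2 ^ ((n : ℤ) - 2) * (M.nodeVal v z - M.val v p.1 p.2 z) ^ 2 :=
        Finset.sum_comm' fun p z => by
          simp only [M.mem_patch, Finset.mem_biUnion]
          exact ⟨fun h => ⟨h, p, h⟩, fun h => h.1⟩
    _ ≤ (N * ρ ^ n + 1) ^ 3 * (8 * max 1 ρ / η₀) *
          ∑ z ∈ M.elems.biUnion M.emb, M.localPenalty ηF ηΓ v z := by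
        rw [Finset.mul_sum]
        exact Finset.sum_le_sum fun z _ => hpatch z
    _ ≤ stabilityConst n N ρ η₀ * ∑ F ∈ M.faces, M.facePenalty ηF ηΓ v F := by
        rw [stabilityConst, mul_assoc _ (n : ℝ)]
        gcongr
        exact M.sum_localPenalty_le v hηF₀ hηΓ₀ _

end Network.Mesh

/-! ### Affine functions on an element -/

lemma abs_le_of_mem_convexHull {V : Type*} [AddCommGroup V] [Module ℝ V] {s : Set V}
    {q : V →ᵃ[ℝ] ℝ} {m : ℝ} (hq : ∀ y ∈ s, |q y| ≤ m) {x : V} (hx : x ∈ convexHull ℝ s) :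
    |q x| ≤ m :=
  abs_le.2 <| convexHull_min (t := q ⁻¹' Icc (-m) m) (fun y hy => abs_le.1 (hq y hy))
    ((convex_Icc (-m) m).affine_preimage q) hx

section Affine

variable {V : Type*} [NormedAddCommGroup V] [InnerProductSpace ℝ V] [FiniteDimensional ℝ V]

lemma affineGrad_sub (p q : V →ᵃ[ℝ] ℝ) : affineGrad (p - q) = affineGrad p - affineGrad q :=
  ext_inner_right ℝ fun u => by
    rw [inner_sub_left, inner_affineGrad, inner_affineGrad, inner_affineGrad]
    rfl

lemma mul_norm_affineGrad_le {q : V →ᵃ[ℝ] ℝ} {c : V} {r m : ℝ} (hr : 0 ≤ r)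
    (hq : ∀ x ∈ Metric.closedBall c r, |q x| ≤ m) : r * ‖affineGrad q‖ ≤ m := by
  rcases eq_or_ne (affineGrad q) 0 with h0 | h0
  · rw [h0, norm_zero, mul_zero]
    exact (abs_nonneg _).trans (hq c (Metric.mem_closedBall_self hr))
  have hnorm : ‖affineGrad q‖ ≠ 0 := norm_ne_zero_iff.2 h0
  let e : V := (r / ‖affineGrad q‖) • affineGrad q
  have he : ‖e‖ = r := by
    rw [norm_smul, norm_div, norm_norm, Real.norm_of_nonneg hr, div_mul_cancel₀ _ hnorm]
  have hlin : q.linear e = r * ‖affineGrad q‖ := by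
    rw [← inner_affineGrad, inner_smul_right, real_inner_self_eq_norm_sq]
    field_simp
  have hadd : q (e + c) = q.linear e + q c := q.map_vadd c e
  have hsub : q (-e + c) = -q.linear e + q c := map_neg q.linear e ▸ q.map_vadd c (-e)
  have hadd_le := (abs_le.1 (hq (e + c) (by simp [he]))).2
  have hsub_le := (abs_le.1 (hq (-e + c) (by simp [he]))).1
  linarith

end Affine

section Element

variable {n : ℕ} {K : Finset (E n)} {q : E n →ᵃ[ℝ] ℝ} {m : ℝ}

/-- The volume of the unit ball of `ℝⁿ`. -/
def ballVolume (n : ℕ) : ℝ := volume.real (Metric.ball (0 : E n) 1)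

lemma volume_real_convexHull_le (hK : K.Nonempty) :
    volume.real (convexHull ℝ (K : Set (E n))) ≤ size K ^ n * ballVolume n := by
  obtain ⟨y, hy⟩ := hK
  calc volume.real (convexHull ℝ (K : Set (E n)))
      ≤ volume.real (Metric.closedBall y (size K)) :=
        measureReal_mono (fun x hx => dist_le_size hx (subset_convexHull ℝ _ hy))
          measure_closedBall_lt_top.ne
    _ = size K ^ n * ballVolume n := by
        rw [Measure.addHaar_real_closedBall _ _ (size_nonneg K), finrank_euclideanSpace_fin,
          ballVolume]

/-- The sum of the squares of the values of `q` at the vertices of the element `K`, with the power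
of the size of `K` for which it scales as the squared `L²` norm of the gradient. -/
def vertexNormSq (K : Finset (E n)) (q : E n →ᵃ[ℝ] ℝ) : ℝ :=
  size K ^ ((n : ℤ) - 2) * ∑ y ∈ K, q y ^ 2

lemma vertexNormSq_nonneg (K : Finset (E n)) (q : E n →ᵃ[ℝ] ℝ) : 0 ≤ vertexNormSq K q :=
  mul_nonneg (zpow_nonneg (size_nonneg K) _) (Finset.sum_nonneg fun _ _ => sq_nonneg _)

lemma size_pow_mul_sum_sq (hs : size K ≠ 0) (q : E n →ᵃ[ℝ] ℝ) :
    size K ^ n * ∑ y ∈ K, q y ^ 2 = size K ^ 2 * vertexNormSq K q := by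
  rw [vertexNormSq, zpow_sub₀ hs, zpow_natCast, ← mul_assoc]
  congr 1
  field_simp

lemma abs_le_sqrt_sum_sq {x : E n} (hx : x ∈ convexHull ℝ (K : Set (E n))) :
    |q x| ≤ √(∑ y ∈ K, q y ^ 2) :=
  abs_le_of_mem_convexHull (fun _ hy => Real.abs_le_sqrt <|
    Finset.single_le_sum (f := fun y => q y ^ 2) (fun _ _ => sq_nonneg _) hy) hx

lemma setIntegral_sq_le_vertexNormSq (hs : size K ≠ 0) (hK : K.Nonempty) :
    ∫ x in convexHull ℝ (K : Set (E n)), q x ^ 2 ≤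
      ballVolume n * (size K ^ 2 * vertexNormSq K q) := by
  have hsum : 0 ≤ ∑ y ∈ K, q y ^ 2 := Finset.sum_nonneg fun _ _ => sq_nonneg _
  calc ∫ x in convexHull ℝ (K : Set (E n)), q x ^ 2
      ≤ (∑ y ∈ K, q y ^ 2) * volume.real (convexHull ℝ (K : Set (E n))) :=
        (Real.le_norm_self _).trans <| norm_setIntegral_le_of_norm_le_const
          (K.finite_toSet.isCompact_convexHull (𝕜 := ℝ)).measure_lt_top fun x hx => by
            rw [norm_pow, Real.norm_eq_abs, ← Real.sq_sqrt hsum]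
            exact pow_le_pow_left₀ (abs_nonneg _) (abs_le_sqrt_sum_sq hx) 2
    _ ≤ (∑ y ∈ K, q y ^ 2) * (size K ^ n * ballVolume n) :=
        mul_le_mul_of_nonneg_left (volume_real_convexHull_le hK) hsum
    _ = ballVolume n * (size K ^ 2 * vertexNormSq K q) := by
        rw [← size_pow_mul_sum_sq hs]
        ring

lemma setIntegral_norm_affineGrad_sq_le_vertexNormSq (hs : size K ≠ 0) (hK : K.Nonempty) {ρ : ℝ}
    (hρ : 0 < ρ) {c : E n}
    (hc : Metric.closedBall c (size K / ρ) ⊆ convexHull ℝ (K : Set (E n))) :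
    ∫ _ in convexHull ℝ (K : Set (E n)), ‖affineGrad q‖ ^ 2 ≤
      ρ ^ 2 * ballVolume n * vertexNormSq K q := by
  have hsum : 0 ≤ ∑ y ∈ K, q y ^ 2 := Finset.sum_nonneg fun _ _ => sq_nonneg _
  have hgrad : (size K / ρ) ^ 2 * ‖affineGrad q‖ ^ 2 ≤ ∑ y ∈ K, q y ^ 2 := by
    rw [← mul_pow, ← Real.sq_sqrt hsum]
    have := size_nonneg K
    exact pow_le_pow_left₀ (by positivity)
      (mul_norm_affineGrad_le (by positivity) fun x hx => abs_le_sqrt_sum_sq (hc hx)) 2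
  rw [setIntegral_const, smul_eq_mul]
  calc volume.real (convexHull ℝ (K : Set (E n))) * ‖affineGrad q‖ ^ 2
      ≤ size K ^ n * ballVolume n * ‖affineGrad q‖ ^ 2 :=
        mul_le_mul_of_nonneg_right (volume_real_convexHull_le hK) (sq_nonneg _)
    _ = ρ ^ 2 * ballVolume n / size K ^ 2 *
          (size K ^ n * ((size K / ρ) ^ 2 * ‖affineGrad q‖ ^ 2)) := by
        field_simp
    _ ≤ ρ ^ 2 * ballVolume n / size K ^ 2 * (size K ^ n * ∑ y ∈ K, q y ^ 2) := by
        have := size_nonneg K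
        have : 0 ≤ ballVolume n := measureReal_nonneg
        gcongr
    _ = ρ ^ 2 * ballVolume n * vertexNormSq K q := by
        rw [size_pow_mul_sum_sq hs]
        field_simp

end Element

/-! ### The estimates -/

section Constant

variable {n N : ℕ} {ρ η₀ : ℝ}

/-- The constant of the stability estimates, which does not depend on the network. -/
def enrichConst (n N : ℕ) (ρ η₀ : ℝ) : ℝ :=
  √(2 + (1 + 2 * ρ ^ 2) * ballVolume n * stabilityConst n N ρ η₀)

lemma ballVolume_mul_stabilityConst_nonneg (hρ : 0 < ρ) (hη₀ : 0 < η₀) :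
    0 ≤ ballVolume n * stabilityConst n N ρ η₀ := by
  have hV : 0 ≤ ballVolume n := measureReal_nonneg
  rw [stabilityConst]
  positivity

lemma sq_enrichConst (hρ : 0 < ρ) (hη₀ : 0 < η₀) : enrichConst n N ρ η₀ ^ 2 =
    2 + (1 + 2 * ρ ^ 2) * (ballVolume n * stabilityConst n N ρ η₀) := by
  have hVS := ballVolume_mul_stabilityConst_nonneg (n := n) (N := N) hρ hη₀
  rw [enrichConst, mul_assoc, Real.sq_sqrt (by positivity)]

lemma enrichConst_pos (hρ : 0 < ρ) (hη₀ : 0 < η₀) : 0 < enrichConst n N ρ η₀ := by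
  have hVS := ballVolume_mul_stabilityConst_nonneg (n := n) (N := N) hρ hη₀
  rw [enrichConst, mul_assoc, Real.sqrt_pos]
  positivity

end Constant

namespace Network.Mesh

variable {n d N : ℕ} {G : Network n d N} (M : G.Mesh) {ηF : Fin N → Finset (E d) → ℝ}
  {ηΓ : Set (E d) → ℝ} (v : Fin N → E n → ℝ) {i : Fin N} {K : Finset (E n)} {ρ η₀ : ℝ}

lemma setIntegral_le_sum {f : E n → ℝ} (hf : 0 ≤ f) {g : Finset (E n) → E n → ℝ}
    (hg : ∀ K ∈ M.T i, Continuous (g K))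
    (hfg : ∀ K ∈ M.T i, f =ᵐ[volume.restrict (convexHull ℝ (K : Set (E n)))] g K) :
    ∫ x in G.Ω i, f x ≤ ∑ K ∈ M.T i, ∫ x in convexHull ℝ (K : Set (E n)), g K x := by
  have hcover : G.Ω i ⊆ ⋃ K ∈ (M.T i : Set (Finset (E n))), convexHull ℝ (K : Set (E n)) :=
    subset_closure.trans (M.cover i).ge
  have hle : volume.restrict (G.Ω i) ≤
      ∑ K ∈ M.T i, volume.restrict (convexHull ℝ (K : Set (E n))) := by
    refine (Measure.restrict_mono_set _ hcover).trans
      ((Measure.restrict_biUnion_le (M.T i).countable_toSet).trans_eq ?_)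
    rw [Measure.sum_fintype]
    exact Finset.sum_coe_sort (M.T i) fun K => volume.restrict (convexHull ℝ (K : Set (E n)))
  have hint : ∀ K ∈ M.T i, IntegrableOn f (convexHull ℝ (K : Set (E n))) := fun K hK =>
    ((hg K hK).continuousOn.integrableOn_compact
      (K.finite_toSet.isCompact_convexHull (𝕜 := ℝ))).congr_fun_ae (hfg K hK).symm
  rw [← Finset.sum_congr rfl fun K hK => integral_congr_ae (hfg K hK),
    ← integral_finsetSum_measure hint]
  exact integral_mono_measure hle (ae_of_all _ hf) (integrable_finsetSum_measure.2 hint)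

/-- The restriction of `E_h v - v` to an element. -/
def diffPoly (i : Fin N) (K : Finset (E n)) : E n →ᵃ[ℝ] ℝ :=
  M.enrichPoly v i K - elemPoly (v i) K

lemma diffPoly_apply_vertex (hK : K ∈ M.T i) {y : E n} (hy : y ∈ K) :
    M.diffPoly v i K y = M.nodeVal v (G.Φ i y) - M.val v i K (G.Φ i y) := by
  rw [val_apply, ← M.enrichPoly_apply_vertex v hK hy]
  rfl

lemma ae_enrich_sub_eq_diffPoly (hv : M.MemV v) (hK : K ∈ M.T i) :
    (fun x => M.enrich v i x - v i x)
      =ᵐ[volume.restrict (convexHull ℝ (K : Set (E n)))] M.diffPoly v i K :=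
  (M.agreesOn_enrich v hK).sub (agreesOn_elemPoly ((hv i).2 K hK))

lemma ae_gradient_enrich_eq (hK : K ∈ M.T i) :
    ∇ (M.enrich v i) =ᵐ[volume.restrict (convexHull ℝ (K : Set (E n)))]
      fun _ => affineGrad (M.enrichPoly v i K) := by
  rw [← Measure.restrict_congr_set
    (interior_ae_eq_of_null_frontier ((convex_convexHull ℝ _).addHaar_frontier volume))]
  refine ae_restrict_of_forall_mem isOpen_interior.measurableSet fun x hx => ?_
  have heq : M.enrich v i =ᶠ[𝓝 x] M.enrichPoly v i K :=
    mem_of_superset (isOpen_interior.mem_nhds hx) fun y hy =>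
      M.enrich_apply v hK (interior_subset hy)
  rw [heq.gradient_eq, gradient_affineMap]

lemma setIntegral_norm_weakGrad_enrich_sq (i : Fin N) :
    ∫ x in G.Ω i, ‖weakGrad (G.Ω i) (M.enrich v i) x‖ ^ 2 =
      ∫ x in G.Ω i, ‖∇ (M.enrich v i) x‖ ^ 2 :=
  integral_congr_ae <| ((M.hasWeakGradient_enrich v i).weakGrad_ae_eq
    (G.polytopal i).isOpen).mono fun x hx => by simp only [hx]

lemma sum_setIntegral_norm_gradient_sq_le_dgNorm (hηF : ∀ i F, 0 ≤ ηF i F)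
    (hηΓ : ∀ γ, 0 ≤ ηΓ γ) :
    ∑ i, ∑ K ∈ M.T i,
        (∫ x in convexHull ℝ (K : Set (E n)), ‖∇ (elemPoly (v i) K : E n → ℝ) x‖ ^ 2) ≤
      M.dgNorm ηF ηΓ v ^ 2 := by
  rw [M.sq_dgNorm v hηF hηΓ]
  exact le_add_of_nonneg_right <|
    Finset.sum_nonneg fun F _ => M.facePenalty_nonneg v hηF hηΓ F

lemma sum_facePenalty_le_dgNorm (hηF : ∀ i F, 0 ≤ ηF i F) (hηΓ : ∀ γ, 0 ≤ ηΓ γ) :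
    ∑ F ∈ M.faces, M.facePenalty ηF ηΓ v F ≤ M.dgNorm ηF ηΓ v ^ 2 := by
  rw [M.sq_dgNorm v hηF hηΓ]
  exact le_add_of_nonneg_left <| Finset.sum_nonneg fun i _ => Finset.sum_nonneg fun K _ =>
    integral_nonneg fun _ => sq_nonneg _

lemma sum_vertexNormSq_diffPoly_le_dgNorm (hn : n = 1 ∨ n = 2) (hρ : 0 < ρ)
    (hM : M.ShapeRegular ρ) (hη₀ : 0 < η₀) (hηF : ∀ i F, η₀ ≤ ηF i F) (hηΓ : ∀ γ, η₀ ≤ ηΓ γ) :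
    ∑ i, ∑ K ∈ M.T i, vertexNormSq K (M.diffPoly v i K) ≤
      stabilityConst n N ρ η₀ * M.dgNorm ηF ηΓ v ^ 2 := by
  have hvertex : ∑ i, ∑ K ∈ M.T i, vertexNormSq K (M.diffPoly v i K) =
      ∑ p ∈ M.elems, ∑ z ∈ M.emb p,
        size p.2 ^ ((n : ℤ) - 2) * (M.nodeVal v z - M.val v p.1 p.2 z) ^ 2 := by
    rw [elems, Finset.sum_sigma]
    refine Finset.sum_congr rfl fun i _ => Finset.sum_congr rfl fun K hK => ?_
    rw [vertexNormSq, Finset.mul_sum, emb, Finset.sum_image (G.Φ i).injective.injOn]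
    exact Finset.sum_congr rfl fun y hy => by rw [M.diffPoly_apply_vertex v hK hy]
  rw [hvertex]
  refine (M.sum_sq_nodeVal_sub_le v hn hM hη₀ hηF hηΓ hρ).trans <| mul_le_mul_of_nonneg_left
    (M.sum_facePenalty_le_dgNorm v (fun i F => hη₀.le.trans (hηF i F))
      fun γ => hη₀.le.trans (hηΓ γ)) ?_
  rw [stabilityConst]
  positivity

lemma setIntegral_sq_enrich_sub_le (hn : 0 < n) (hv : M.MemV v) (i : Fin N) :
    ∫ x in G.Ω i, (M.enrich v i x - v i x) ^ 2 ≤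
      ballVolume n * M.h ^ 2 * ∑ K ∈ M.T i, vertexNormSq K (M.diffPoly v i K) := by
  refine (M.setIntegral_le_sum (fun _ => sq_nonneg _)
    (fun K _ => (M.diffPoly v i K).continuous_of_finiteDimensional.pow 2) fun K hK =>
      (M.ae_enrich_sub_eq_diffPoly v hv hK).fun_comp (· ^ 2)).trans ?_
  rw [Finset.mul_sum]
  refine Finset.sum_le_sum fun K hK => ?_
  have hV : 0 ≤ ballVolume n := measureReal_nonneg
  have hvertex := vertexNormSq_nonneg K (M.diffPoly v i K)
  refine (setIntegral_sq_le_vertexNormSq (M.size_elem_pos hn hK).ne'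
    (Finset.card_pos.1 (by simp [M.card_eq i K hK]))).trans ?_
  rw [mul_assoc]
  gcongr
  exacts [size_nonneg K, M.size_le_h (p := ⟨i, K⟩) (M.mem_elems.2 hK)]

lemma setIntegral_norm_gradient_enrich_sq_le (hn : 0 < n) (hρ : 0 < ρ) (hM : M.ShapeRegular ρ)
    (i : Fin N) :
    ∫ x in G.Ω i, ‖∇ (M.enrich v i) x‖ ^ 2 ≤
      2 * ∑ K ∈ M.T i,
          (∫ x in convexHull ℝ (K : Set (E n)), ‖∇ (elemPoly (v i) K : E n → ℝ) x‖ ^ 2) +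
        2 * ρ ^ 2 * ballVolume n * ∑ K ∈ M.T i, vertexNormSq K (M.diffPoly v i K) := by
  refine (M.setIntegral_le_sum (g := fun K _ => ‖affineGrad (M.enrichPoly v i K)‖ ^ 2)
    (fun _ => sq_nonneg _) (fun K _ => continuous_const) fun K hK =>
      (M.ae_gradient_enrich_eq v hK).fun_comp fun u => ‖u‖ ^ 2).trans ?_
  rw [Finset.mul_sum, Finset.mul_sum, ← Finset.sum_add_distrib]
  refine Finset.sum_le_sum fun K hK => ?_
  obtain ⟨c, hc⟩ := hM.1 ⟨i, K⟩ (M.mem_elems.2 hK)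
  have hdiff := setIntegral_norm_affineGrad_sq_le_vertexNormSq (q := M.diffPoly v i K)
    (M.size_elem_pos hn hK).ne' (Finset.card_pos.1 (by simp [M.card_eq i K hK])) hρ hc
  have hsq : ‖affineGrad (M.enrichPoly v i K)‖ ^ 2 ≤
      2 * ‖affineGrad (elemPoly (v i) K)‖ ^ 2 + 2 * ‖affineGrad (M.diffPoly v i K)‖ ^ 2 := by
    rw [← mul_add, diffPoly, affineGrad_sub]
    refine (pow_le_pow_left₀ (norm_nonneg _) (norm_le_insert' _ _) 2).trans add_sq_le
  simp only [gradient_affineMap, setIntegral_const, smul_eq_mul] at hdiff ⊢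
  have hvol : 0 ≤ volume.real (convexHull ℝ (K : Set (E n))) := measureReal_nonneg
  linarith [mul_le_mul_of_nonneg_left hsq hvol]

section Estimates

variable (hn : n = 1 ∨ n = 2) (hρ : 0 < ρ) (hM : M.ShapeRegular ρ) (hη₀ : 0 < η₀)
  (hηF : ∀ i F, η₀ ≤ ηF i F) (hηΓ : ∀ γ, η₀ ≤ ηΓ γ)

include hn hρ hM hη₀ hηF hηΓ

lemma sum_setIntegral_sq_enrich_sub_le (hv : M.MemV v) :
    ∑ i, ∫ x in G.Ω i, (M.enrich v i x - v i x) ^ 2 ≤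
      (enrichConst n N ρ η₀ * M.h * M.dgNorm ηF ηΓ v) ^ 2 := by
  have hVS := ballVolume_mul_stabilityConst_nonneg (n := n) (N := N) hρ hη₀
  have hV : 0 ≤ ballVolume n := measureReal_nonneg
  calc ∑ i, ∫ x in G.Ω i, (M.enrich v i x - v i x) ^ 2
      ≤ ballVolume n * M.h ^ 2 * ∑ i, ∑ K ∈ M.T i, vertexNormSq K (M.diffPoly v i K) := by
        rw [Finset.mul_sum]
        exact Finset.sum_le_sum fun i _ => M.setIntegral_sq_enrich_sub_le v (by omega) hv i
    _ ≤ ballVolume n * M.h ^ 2 * (stabilityConst n N ρ η₀ * M.dgNorm ηF ηΓ v ^ 2) := by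
        gcongr
        exact M.sum_vertexNormSq_diffPoly_le_dgNorm v hn hρ hM hη₀ hηF hηΓ
    _ = ballVolume n * stabilityConst n N ρ η₀ * (M.h * M.dgNorm ηF ηΓ v) ^ 2 := by ring
    _ ≤ enrichConst n N ρ η₀ ^ 2 * (M.h * M.dgNorm ηF ηΓ v) ^ 2 := by
        rw [sq_enrichConst hρ hη₀]
        gcongr
        nlinarith [mul_nonneg (sq_nonneg ρ) hVS]
    _ = (enrichConst n N ρ η₀ * M.h * M.dgNorm ηF ηΓ v) ^ 2 := by ring

lemma sum_setIntegral_norm_weakGrad_enrich_sq_le :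
    ∑ i, ∫ x in G.Ω i, ‖weakGrad (G.Ω i) (M.enrich v i) x‖ ^ 2 ≤
      (enrichConst n N ρ η₀ * M.dgNorm ηF ηΓ v) ^ 2 := by
  have hVS := ballVolume_mul_stabilityConst_nonneg (n := n) (N := N) hρ hη₀
  have hV : 0 ≤ ballVolume n := measureReal_nonneg
  calc ∑ i, ∫ x in G.Ω i, ‖weakGrad (G.Ω i) (M.enrich v i) x‖ ^ 2
      ≤ 2 * ∑ i, ∑ K ∈ M.T i,
            (∫ x in convexHull ℝ (K : Set (E n)), ‖∇ (elemPoly (v i) K : E n → ℝ) x‖ ^ 2) +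
          2 * ρ ^ 2 * ballVolume n *
            ∑ i, ∑ K ∈ M.T i, vertexNormSq K (M.diffPoly v i K) := by
        rw [Finset.mul_sum, Finset.mul_sum, ← Finset.sum_add_distrib]
        refine Finset.sum_le_sum fun i _ => ?_
        rw [M.setIntegral_norm_weakGrad_enrich_sq v i]
        exact M.setIntegral_norm_gradient_enrich_sq_le v (by omega) hρ hM i
    _ ≤ 2 * M.dgNorm ηF ηΓ v ^ 2 +
          2 * ρ ^ 2 * ballVolume n * (stabilityConst n N ρ η₀ * M.dgNorm ηF ηΓ v ^ 2) := by
        gcongr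
        · exact M.sum_setIntegral_norm_gradient_sq_le_dgNorm v
            (fun i F => hη₀.le.trans (hηF i F)) fun γ => hη₀.le.trans (hηΓ γ)
        · exact M.sum_vertexNormSq_diffPoly_le_dgNorm v hn hρ hM hη₀ hηF hηΓ
    _ = (2 + 2 * ρ ^ 2 * (ballVolume n * stabilityConst n N ρ η₀)) * M.dgNorm ηF ηΓ v ^ 2 := by
        ring
    _ ≤ enrichConst n N ρ η₀ ^ 2 * M.dgNorm ηF ηΓ v ^ 2 := by
        rw [sq_enrichConst hρ hη₀]
        gcongr
        linarith
    _ = (enrichConst n N ρ η₀ * M.dgNorm ηF ηΓ v) ^ 2 := by ring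

end Estimates

end Network.Mesh

end HyperDG

end

/-- The constant depends on the network only through `n` and the number of domains. -/
theorem mainTheorem4_general (n N : ℕ) (hn : n = 1 ∨ n = 2) (ρ η₀ : ℝ) (hρ : 0 < ρ)
    (hη₀ : 0 < η₀) :
    ∃ C : ℝ, 0 < C ∧ ∀ (d : ℕ) (G : HyperDG.Network n d N) (M : G.Mesh), M.ShapeRegular ρ →
      ∀ (ηF : Fin N → Finset (HyperDG.E d) → ℝ) (ηΓ : Set (HyperDG.E d) → ℝ),
      (∀ i F, η₀ ≤ ηF i F) → (∀ γ, η₀ ≤ ηΓ γ) →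
      ∀ v : Fin N → HyperDG.E n → ℝ, M.MemV v →
        (M.MemV (M.enrich v) ∧ G.MemH10 (M.enrich v)) ∧
        (∀ z ∈ M.nodes, ∀ p ∈ M.patch z,
          M.val (M.enrich v) p.1 p.2 z =
            (∑ q ∈ M.patch z, M.val v q.1 q.2 z) / ((M.patch z).card : ℝ)) ∧
        Real.sqrt (∑ i, ∫ x in G.Ω i, (M.enrich v i x - v i x) ^ 2) ≤
          C * M.h * M.dgNorm ηF ηΓ v ∧
        Real.sqrt (∑ i, ∫ x in G.Ω i, ‖HyperDG.weakGrad (G.Ω i) (M.enrich v i) x‖ ^ 2) ≤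
          C * M.dgNorm ηF ηΓ v := by
  refine ⟨HyperDG.enrichConst n N ρ η₀, HyperDG.enrichConst_pos hρ hη₀,
    fun d G M hM ηF ηΓ hηF hηΓ v hv => ⟨⟨M.memV_enrich v, M.memH10_enrich v hn⟩,
      fun z hz p hp => ?_, ?_, ?_⟩⟩
  · rw [M.val_enrich v hp, M.nodeVal_of_notMem_boundary v hp (Finset.mem_filter.1 hz).2,
      HyperDG.Network.Mesh.nodalAvg, div_eq_inv_mul]
  · have hC := (HyperDG.enrichConst_pos (n := n) (N := N) hρ hη₀).le
    have hh : 0 ≤ M.h := Real.iSup_nonneg fun p => HyperDG.size_nonneg p.1.2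
    exact Real.sqrt_le_iff.2 ⟨mul_nonneg (mul_nonneg hC hh) (Real.sqrt_nonneg _),
      M.sum_setIntegral_sq_enrich_sub_le v hn hρ hM hη₀ hηF hηΓ hv⟩
  · have hC := (HyperDG.enrichConst_pos (n := n) (N := N) hρ hη₀).le
    exact Real.sqrt_le_iff.2 ⟨mul_nonneg hC (Real.sqrt_nonneg _),
      M.sum_setIntegral_norm_weakGrad_enrich_sq_le v hn hρ hM hη₀ hηF hηΓ⟩

theorem mainTheorem4 (n d N : ℕ) (hn : n = 1 ∨ n = 2) (G : HyperDG.Network n d N)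
    (ρ η₀ : ℝ) (hρ : 0 < ρ) (hη₀ : 0 < η₀) :
    ∃ C : ℝ, 0 < C ∧ ∀ M : G.Mesh, M.ShapeRegular ρ →
      ∀ (ηF : Fin N → Finset (HyperDG.E d) → ℝ) (ηΓ : Set (HyperDG.E d) → ℝ),
      (∀ i F, η₀ ≤ ηF i F) → (∀ γ, η₀ ≤ ηΓ γ) →
      ∀ v : Fin N → HyperDG.E n → ℝ, M.MemV v →
        (M.MemV (M.enrich v) ∧ G.MemH10 (M.enrich v)) ∧
        (∀ z ∈ M.nodes, ∀ p ∈ M.patch z,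
          M.val (M.enrich v) p.1 p.2 z =
            (∑ q ∈ M.patch z, M.val v q.1 q.2 z) / ((M.patch z).card : ℝ)) ∧
        Real.sqrt (∑ i, ∫ x in G.Ω i, (M.enrich v i x - v i x) ^ 2) ≤
          C * M.h * M.dgNorm ηF ηΓ v ∧
        Real.sqrt (∑ i, ∫ x in G.Ω i,
            ‖HyperDG.weakGrad (G.Ω i) (M.enrich v i) x‖ ^ 2) ≤
          C * M.dgNorm ηF ηΓ v := by
  obtain ⟨C, hC, h⟩ := mainTheorem4_general n N hn ρ η₀ hρ hη₀
  exact ⟨C, hC, h d G⟩
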